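/- Let $G$ be an ample groupoid with compact unit space: a locally compact Hausdorff topological groupoid whose range and source maps $r,s\colon G\to G^{(0)}$ are local homeomorphisms and whose unit space $G^{(0)}$ is compact and totally disconnected. A bisection is a subset of $G$ on which $r$ and $s$ are injective, and the topological full group $[[G]]$ is the group of compact open bisections $U\subset G$ with $r(U)=s(U)=G^{(0)}$, with product $UV=\{ab : a\in U,\ b\in V,\ s(a)=r(b)\}$. Let $\mathrm C^*(G)$ be the full groupoid $\mathrm C^*$-algebra, i.e. the completion of the convolution $*$-algebra $C_c(G)$ in the norm $\|f\|=\sup_\varphi\|\varphi(f)\|$, where $\varphi$ runs over all $*$-representations of $C_c(G)$ on Hilbert spaces, and let $\pi\colon[[G]]\to \mathrm C^*(G)$, $\pi(U)=1_U$, be the canonical unitary representation. Let $\Gamma\le[[G]]$ be a subgroup, and let $\mathrm C^*_\pi(\Gamma)$ be the $\mathrm C^*$-subalgebra of $\mathrm C^*(G)$ generated by $\pi(\Gamma)$. Consider the following conditions. 1. There is a $G$-invariant regular Borel probability measure $\mu$ on $G^{(0)}$, that is, one with $\mu(r(S))=\mu(s(S))$ for every open bisection $S\subset G$. 2. $\pi|_\Gamma$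 weakly contains the trivial representation, that is, $\left|\sum_i\alpha_i\right|\le\left\|\sum_i\alpha_i\pi(g_i)\right\|$ for every $\sum_i\alpha_i g_i\in\mathbb C\Gamma$. 3. $\mathrm C^*_\pi(\Gamma)$ admits a character (a nonzero multiplicative linear functional). 4. There is a $\Gamma$-invariant regular Borel probability measure on $G^{(0)}$, that is, one that is invariant under the homeomorphism $\theta_U=r\circ(s|_U)^{-1}$ of $G^{(0)}$ for every $U\in\Gamma$. Then (1) $\Rightarrow$ (2) $\Rightarrow$ (3) $\Rightarrow$ (4). If $\Gamma$ covers $G$, that is, if $G=\bigcup_{U\in\Gamma}U$, then (4) $\Rightarrow$ (1), and all four conditions are equivalent. -/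

import Mathlib

universe u

set_option linter.unusedSectionVars false

/-- A topological groupoid, presented by its space `G` of arrows. The unit space is the set of
arrows `x` with `src x = x`, and `a * b` is the product of a composable pair, that is, of a pair
with `src a = rng b`. The value of `a * b` for other pairs is irrelevant (a total multiplication is
only a coding of the partial one): no axiom mentions it and no definition below uses it. -/
class TopologicalGroupoid (G : Type u) [TopologicalSpace G] extends Mul G, Inv G where
  src : G → G
  rng : G → G
  rng_inv : ∀ a, rng a⁻¹ = src a
  src_inv : ∀ a, src a⁻¹ = rng a
  src_mul : ∀ a b, src a = rng b → src (a * b) = src b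
  rng_mul : ∀ a b, src a = rng b → rng (a * b) = rng a
  gmul_assoc : ∀ a b c, src a = rng b → src b = rng c → a * b * c = a * (b * c)
  inv_gmul : ∀ a, a⁻¹ * a = src a
  gmul_inv : ∀ a, a * a⁻¹ = rng a
  rng_gmul : ∀ a, rng a * a = a
  gmul_src : ∀ a, a * src a = a
  continuous_inv : Continuous (fun a : G => a⁻¹)
  continuousOn_mul : ContinuousOn (fun p : G × G => p.1 * p.2) {p | src p.1 = rng p.2}

namespace TopologicalGroupoid

section Algebraic

variable {G : Type u} [TopologicalSpace G] [TopologicalGroupoid G]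

theorem src_src (a : G) : src (src a) = src a := by
  rw [← inv_gmul a, src_mul _ _ (src_inv a), inv_gmul]

theorem rng_src (a : G) : rng (src a) = src a := by
  rw [← inv_gmul a, rng_mul _ _ (src_inv a), rng_inv, inv_gmul]

theorem src_rng (a : G) : src (rng a) = rng a := by
  rw [← src_inv a, src_src]

theorem rng_rng (a : G) : rng (rng a) = rng a := by
  rw [← src_inv a, rng_src]

theorem inv_inv' (a : G) : a⁻¹⁻¹ = a := by
  have h := gmul_assoc a⁻¹⁻¹ a⁻¹ a (by rw [src_inv]) (by rw [src_inv])
  rw [inv_gmul a⁻¹, src_inv, rng_gmul, inv_gmul, ← rng_inv, ← src_inv, gmul_src] at h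
  exact h.symm

theorem inv_mul_cancel_left' {a b : G} (h : src a = rng b) : a⁻¹ * (a * b) = b := by
  rw [← gmul_assoc _ _ _ (src_inv a) h, inv_gmul, h, rng_gmul]

theorem mul_inv_cancel_left' {a b : G} (h : rng a = rng b) : a * (a⁻¹ * b) = b := by
  rw [← gmul_assoc _ _ _ (rng_inv a).symm (by rw [src_inv, h]), gmul_inv, h, rng_gmul]

theorem mul_inv_cancel_right' {a b : G} (h : src a = rng b) : a * b * b⁻¹ = a := by
  rw [gmul_assoc _ _ _ h (rng_inv b).symm, gmul_inv, ← h, gmul_src]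

theorem mul_inv_rev' {a b : G} (h : src a = rng b) : (a * b)⁻¹ = b⁻¹ * a⁻¹ := by
  have h1 : src b⁻¹ = rng a⁻¹ := by rw [src_inv, rng_inv, h]
  have h2 : src (a * b) = rng (b⁻¹ * a⁻¹) := by rw [src_mul _ _ h, rng_mul _ _ h1, rng_inv]
  have h3 : (a * b) * (b⁻¹ * a⁻¹) = rng a := by
    rw [← gmul_assoc _ _ _ (by rw [src_mul _ _ h, rng_inv]) h1, mul_inv_cancel_right' h, gmul_inv]
  have h4 := inv_mul_cancel_left' h2
  rw [h3, ← rng_mul _ _ h, ← src_inv (a * b), gmul_src] at h4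
  exact h4

theorem rng_of_src {x : G} (h : src x = x) : rng x = x := by
  rw [← h, rng_src]

theorem inv_of_src {x : G} (h : src x = x) : x⁻¹ = x := by
  have := gmul_inv x
  rw [rng_of_src h] at this
  have h2 := rng_gmul x⁻¹
  rw [rng_inv, h, this] at h2
  exact h2.symm

variable (G) in
/-- The unit space as a subset of `G`. -/
def unitSet : Set G := {x | src x = x}

variable (G) in
/-- The unit space `G⁽⁰⁾`, with the topology induced from `G`. -/
abbrev UnitSpace : Type u := {x : G // src x = x}

/-- The range map `r : G → G⁽⁰⁾`. -/
def rngMap (a : G) : UnitSpace G := ⟨rng a, src_rng a⟩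

/-- The source map `s : G → G⁽⁰⁾`. -/
def srcMap (a : G) : UnitSpace G := ⟨src a, src_src a⟩

/-- A bisection: a subset on which the range and source maps are injective. -/
def IsBisection (S : Set G) : Prop := Set.InjOn rng S ∧ Set.InjOn src S

/-- The product `S T = {a b | a ∈ S, b ∈ T, (a, b) composable}` of two subsets. -/
def setMul (S T : Set G) : Set G := {c | ∃ a ∈ S, ∃ b ∈ T, src a = rng b ∧ a * b = c}

end Algebraic

/-- An ample groupoid: locally compact, Hausdorff, étale (the range and source maps are local
homeomorphisms onto the unit space), with totally disconnected unit space. -/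
class IsAmple (G : Type u) [TopologicalSpace G] [TopologicalGroupoid G] : Prop where
  t2 : T2Space G
  locallyCompact : LocallyCompactSpace G
  isLocalHomeomorph_rng : IsLocalHomeomorph (rngMap : G → UnitSpace G)
  isLocalHomeomorph_src : IsLocalHomeomorph (srcMap : G → UnitSpace G)
  totallyDisconnected : TotallyDisconnectedSpace (UnitSpace G)

attribute [instance] IsAmple.t2 IsAmple.locallyCompact IsAmple.totallyDisconnected

section Topological

variable {G : Type u} [TopologicalSpace G] [TopologicalGroupoid G] [IsAmple G]

theorem continuous_rng : Continuous (rng : G → G) :=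
  continuous_subtype_val.comp IsAmple.isLocalHomeomorph_rng.continuous

theorem continuous_src : Continuous (src : G → G) :=
  continuous_subtype_val.comp IsAmple.isLocalHomeomorph_src.continuous

theorem isOpen_unitSet : IsOpen (unitSet G) := by
  rw [isOpen_iff_mem_nhds]
  intro x hx
  obtain ⟨e, hxe, he⟩ := IsAmple.isLocalHomeomorph_rng x
  have h1 : e.source ∈ nhds x := e.open_source.mem_nhds hxe
  have h2 : rng ⁻¹' e.source ∈ nhds x :=
    continuous_rng.continuousAt (by rw [rng_of_src hx]; exact h1)
  filter_upwards [h1, h2] with g hg hg2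
  have : g = rng g := by
    apply e.injOn hg hg2
    rw [← he]
    exact Subtype.ext (rng_rng g).symm
  show src g = g
  rw [this, src_rng]

theorem isClosed_unitSet : IsClosed (unitSet G) :=
  isClosed_eq continuous_src continuous_id

theorem isClopen_unitSet : IsClopen (unitSet G) := ⟨isClosed_unitSet, isOpen_unitSet⟩

theorem isCompact_unitSet [CompactSpace (UnitSpace G)] : IsCompact (unitSet G) :=
  isCompact_iff_compactSpace.2 (inferInstanceAs (CompactSpace (UnitSpace G)))

theorem unitSet_bisection : IsBisection (unitSet G) := by
  constructor
  · intro x hx y hy h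
    rwa [rng_of_src hx, rng_of_src hy] at h
  · intro x hx y hy h
    rwa [show src x = x from hx, show src y = y from hy] at h

theorem continuousAt_inv_mul {τ : G → G} {γ : G} (hτ : ContinuousAt τ γ)
    (h : ∀ᶠ c in nhds γ, rng (τ c) = rng c) : ContinuousAt (fun c => (τ c)⁻¹ * c) γ := by
  have hγ := h.self_of_nhds
  have h1 := continuousOn_mul (G := G) ((τ γ)⁻¹, γ) (by simp [src_inv, hγ])
  have h2 : Filter.Tendsto (fun c => ((τ c)⁻¹, c)) (nhds γ)
      (nhdsWithin ((τ γ)⁻¹, γ) {p : G × G | src p.1 = rng p.2}) := by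
    apply tendsto_nhdsWithin_of_tendsto_nhds_of_eventually_within
    · exact (continuous_inv.continuousAt.comp hτ).prodMk continuousAt_id
    · filter_upwards [h] with c hc
      simp [src_inv, hc]
  exact h1.tendsto.comp h2

/-- Local sections of the range map. -/
theorem exists_section {S : Set G} (hS : IsOpen S) {a γ : G} (ha : a ∈ S) (h : rng a = rng γ) :
    ∃ τ : G → G, τ γ = a ∧ ContinuousAt τ γ ∧ ∀ᶠ c in nhds γ, τ c ∈ S ∧ rng (τ c) = rng c := by
  obtain ⟨e, hae, he⟩ := IsAmple.isLocalHomeomorph_rng a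
  have hr : rngMap γ = rngMap a := Subtype.ext h.symm
  have hrc : Continuous (rngMap : G → UnitSpace G) := IsAmple.isLocalHomeomorph_rng.continuous
  have hea : e a = rngMap a := by rw [he]
  have hva : e.symm (rngMap γ) = a := by rw [hr, ← hea, e.left_inv hae]
  have ht : rngMap γ ∈ e.target := by rw [hr, ← hea]; exact e.map_source hae
  have hc : ContinuousAt (fun c => e.symm (rngMap c)) γ :=
    ContinuousAt.comp (f := rngMap) (g := e.symm) (e.continuousAt_symm ht) hrc.continuousAt
  refine ⟨fun c => e.symm (rngMap c), hva, hc, ?_⟩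
  have h1 : ∀ᶠ c in nhds γ, e.symm (rngMap c) ∈ S :=
    hc (by simp only [hva]; exact hS.mem_nhds ha)
  have h2 : ∀ᶠ c in nhds γ, rngMap c ∈ e.target := hrc.continuousAt (e.open_target.mem_nhds ht)
  filter_upwards [h1, h2] with c h1 h2
  refine ⟨h1, ?_⟩
  have := e.right_inv h2
  rw [← he] at this
  exact congrArg Subtype.val this

theorem isOpen_setMul {S T : Set G} (hS : IsOpen S) (hT : IsOpen T) : IsOpen (setMul S T) := by
  rw [isOpen_iff_mem_nhds]
  rintro γ ⟨a, ha, b, hb, hab, rfl⟩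
  obtain ⟨τ, h1, h2, h3⟩ := exists_section hS ha (rng_mul _ _ hab).symm
  have h4 := continuousAt_inv_mul h2 (h3.mono fun _ h => h.2)
  have h5 : ∀ᶠ c in nhds (a * b), (τ c)⁻¹ * c ∈ T :=
    h4 (hT.mem_nhds (by simp only [h1]; rwa [inv_mul_cancel_left' hab]))
  filter_upwards [h3, h5] with c h6 h7
  refine ⟨τ c, h6.1, _, h7, ?_, mul_inv_cancel_left' h6.2⟩
  rw [rng_mul _ _ (by rw [src_inv, h6.2]), rng_inv]

theorem isCompact_setMul {S T : Set G} (hS : IsCompact S) (hT : IsCompact T) :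
    IsCompact (setMul S T) := by
  have hcl : IsClosed {p : G × G | src p.1 = rng p.2} :=
    isClosed_eq (continuous_src.comp continuous_fst) (continuous_rng.comp continuous_snd)
  have h1 : IsCompact ((S ×ˢ T) ∩ {p : G × G | src p.1 = rng p.2}) := (hS.prod hT).inter_right hcl
  have h2 := h1.image_of_continuousOn (continuousOn_mul.mono Set.inter_subset_right)
  convert h2 using 1
  ext c
  constructor
  · rintro ⟨a, ha, b, hb, h, rfl⟩
    exact ⟨(a, b), ⟨⟨ha, hb⟩, h⟩, rfl⟩
  · rintro ⟨⟨a, b⟩, ⟨⟨ha, hb⟩, h⟩, rfl⟩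
    exact ⟨a, ha, b, hb, h, rfl⟩

theorem exists_compactOpen_bisection [CompactSpace (UnitSpace G)] (g : G) :
    ∃ S : Set G, g ∈ S ∧ IsOpen S ∧ IsCompact S ∧ IsBisection S := by
  obtain ⟨e, hge, he⟩ := IsAmple.isLocalHomeomorph_rng g
  obtain ⟨e', hge', he'⟩ := IsAmple.isLocalHomeomorph_src g
  have hO : IsOpen (e.source ∩ e'.source) := e.open_source.inter e'.open_source
  have hI : IsOpen (e '' (e.source ∩ e'.source)) :=
    e.isOpen_image_of_subset_source hO Set.inter_subset_left
  obtain ⟨W, hW, hgW, hWI⟩ := compact_exists_isClopen_in_isOpen hI ⟨g, ⟨hge, hge'⟩, rfl⟩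
  have hWt : W ⊆ e.target := hWI.trans (by
    rintro _ ⟨x, hx, rfl⟩
    exact e.map_source hx.1)
  have hsub : e.symm '' W ⊆ e.source ∩ e'.source := by
    rintro _ ⟨w, hw, rfl⟩
    obtain ⟨x, hx, rfl⟩ := hWI hw
    rwa [e.left_inv hx.1]
  refine ⟨e.symm '' W, ⟨_, hgW, e.left_inv hge⟩, ?_, ?_, ?_, ?_⟩
  · exact e.symm.isOpen_image_of_subset_source hW.isOpen hWt
  · exact hW.isClosed.isCompact.image_of_continuousOn (e.continuousOn_symm.mono hWt)
  · intro x hx y hy h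
    apply e.injOn (hsub hx).1 (hsub hy).1
    rw [← he]
    exact Subtype.ext h
  · intro x hx y hy h
    apply e'.injOn (hsub hx).2 (hsub hy).2
    rw [← he']
    exact Subtype.ext h

end Topological

section Convolution

variable {G : Type u} [TopologicalSpace G] [TopologicalGroupoid G]

/-- The convolution product `(f ⋆ g)(c) = ∑_{a b = c} f(a) g(b)`; the sum has only finitely many
nonzero terms if `f` and `g` are continuous with compact support. -/
noncomputable def conv (f g : G → ℂ) (c : G) : ℂ :=
  ∑ᶠ p : {p : G × G // src p.1 = rng p.2 ∧ p.1 * p.2 = c}, f p.1.1 * g p.1.2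

/-- The involution `f*(c) = conj (f(c⁻¹))`. -/
noncomputable def involution (f : G → ℂ) (c : G) : ℂ := (starRingEnd ℂ) (f c⁻¹)

/-- Factorizations of `c` correspond to their left factors. -/
def factorEquiv (c : G) :
    {p : G × G // src p.1 = rng p.2 ∧ p.1 * p.2 = c} ≃ {a : G // rng a = rng c} where
  toFun p := ⟨p.1.1, by
    have h := rng_mul _ _ p.2.1
    rw [p.2.2] at h
    exact h.symm⟩
  invFun a := ⟨(a.1, a.1⁻¹ * c), by
    show src a.1 = rng (a.1⁻¹ * c) ∧ a.1 * (a.1⁻¹ * c) = c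
    exact ⟨by rw [rng_mul _ _ (by rw [src_inv, a.2]), rng_inv], mul_inv_cancel_left' a.2⟩⟩
  left_inv := by
    rintro ⟨⟨a, b⟩, h1, h2⟩
    simp only [Subtype.mk.injEq, Prod.mk.injEq, true_and]
    simp only at h1 h2
    rw [← h2, inv_mul_cancel_left' h1]
  right_inv _ := rfl

theorem conv_eq (f g : G → ℂ) (c : G) :
    conv f g c = ∑ᶠ a : {a : G // rng a = rng c}, f a.1 * g (a.1⁻¹ * c) := by
  unfold conv
  rw [← finsum_comp_equiv (factorEquiv c).symm]
  rfl

theorem conv_eq_of_mem {S : Set G} (hS : Set.InjOn rng S) {f : G → ℂ}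
    (hf : Function.support f ⊆ S) (g : G → ℂ) {a c : G} (ha : a ∈ S) (h : rng a = rng c) :
    conv f g c = f a * g (a⁻¹ * c) := by
  rw [conv_eq]
  rw [finsum_eq_single _ (⟨a, h⟩ : {a : G // rng a = rng c})]
  rintro ⟨b, hb⟩ hne
  by_cases h0 : f b = 0
  · simp [h0]
  · exact absurd (Subtype.ext (hS (hf h0) ha (hb.trans h.symm))) hne

theorem conv_eq_zero {S : Set G} {f : G → ℂ} (hf : Function.support f ⊆ S) (g : G → ℂ) {c : G}
    (h : ∀ a ∈ S, rng a ≠ rng c) : conv f g c = 0 := by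
  rw [conv_eq]
  apply finsum_eq_zero_of_forall_eq_zero
  rintro ⟨b, hb⟩
  by_cases h0 : f b = 0
  · simp [h0]
  · exact absurd hb (h b (hf h0))

theorem conv_assoc_of_support {S : Set G} (hS : Set.InjOn rng S) {f : G → ℂ}
    (hf : Function.support f ⊆ S) (g h : G → ℂ) : conv (conv f g) h = conv f (conv g h) := by
  funext c
  by_cases hex : ∃ a ∈ S, rng a = rng c
  · obtain ⟨a, ha, hac⟩ := hex
    have hac' : src a⁻¹ = rng c := by rw [src_inv, hac]
    rw [conv_eq_of_mem hS hf _ ha hac, conv_eq, conv_eq, ← smul_eq_mul, smul_finsum]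
    have hr : rng (a⁻¹ * c) = src a := by rw [rng_mul _ _ hac', rng_inv]
    let E : {b : G // rng b = rng (a⁻¹ * c)} ≃ {d : G // rng d = rng c} :=
      { toFun := fun b => ⟨a * b.1, by rw [rng_mul _ _ (by rw [b.2, hr]), hac]⟩
        invFun := fun d => ⟨a⁻¹ * d.1, by
          rw [rng_mul _ _ (by rw [src_inv, hac, d.2]), rng_inv, hr]⟩
        left_inv := fun b => Subtype.ext (inv_mul_cancel_left' (by rw [b.2, hr]))
        right_inv := fun d => Subtype.ext (mul_inv_cancel_left' (by rw [hac, d.2])) }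
    rw [← finsum_comp_equiv E]
    apply finsum_congr
    rintro ⟨b, hb⟩
    have hab : src a = rng b := by rw [hb, hr]
    have hE : (E ⟨b, hb⟩).1 = a * b := rfl
    rw [hE, conv_eq_of_mem hS hf _ ha (by rw [rng_mul _ _ hab]), inv_mul_cancel_left' hab,
      mul_inv_rev' hab, gmul_assoc _ _ _ (by rw [src_inv, rng_inv, hab]) hac', smul_eq_mul,
      mul_assoc]
  · push Not at hex
    rw [conv_eq_zero hf _ hex, conv_eq]
    apply finsum_eq_zero_of_forall_eq_zero
    rintro ⟨b, hb⟩
    rw [conv_eq_zero hf _ (fun a ha => by rw [hb]; exact hex a ha), zero_mul]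

theorem conv_smul_left (z : ℂ) (f g : G → ℂ) : conv (z • f) g = z • conv f g := by
  funext c
  simp only [conv, Pi.smul_apply]
  rw [smul_finsum]
  simp only [smul_eq_mul, mul_assoc]

theorem conv_smul_right (z : ℂ) (f g : G → ℂ) : conv f (z • g) = z • conv f g := by
  funext c
  simp only [conv, Pi.smul_apply]
  rw [smul_finsum]
  simp only [smul_eq_mul, mul_left_comm]

theorem involution_conv (f g : G → ℂ) :
    involution (conv f g) = conv (involution g) (involution f) := by
  funext c
  simp only [involution, conv]
  have := AddMonoidHom.map_finsum_of_injective (starRingEnd ℂ).toAddMonoidHom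
    (starRingEnd ℂ).injective
    (fun p : {p : G × G // src p.1 = rng p.2 ∧ p.1 * p.2 = c⁻¹} => f p.1.1 * g p.1.2)
  refine this.trans ?_
  let E : {p : G × G // src p.1 = rng p.2 ∧ p.1 * p.2 = c} ≃
      {p : G × G // src p.1 = rng p.2 ∧ p.1 * p.2 = c⁻¹} :=
    { toFun := fun p => ⟨(p.1.2⁻¹, p.1.1⁻¹), by
        refine ⟨by simp only [src_inv, rng_inv, p.2.1], ?_⟩
        simp only
        rw [← mul_inv_rev' p.2.1, p.2.2]⟩
      invFun := fun p => ⟨(p.1.2⁻¹, p.1.1⁻¹), by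
        refine ⟨by simp only [src_inv, rng_inv, p.2.1], ?_⟩
        simp only
        rw [← mul_inv_rev' p.2.1, p.2.2, inv_inv']⟩
      left_inv := fun p => Subtype.ext (Prod.ext (inv_inv' _) (inv_inv' _))
      right_inv := fun p => Subtype.ext (Prod.ext (inv_inv' _) (inv_inv' _)) }
  rw [← finsum_comp_equiv E]
  apply finsum_congr
  rintro ⟨⟨a, b⟩, hp⟩
  simp [E, mul_comm]

variable (G) in
/-- The space of continuous compactly supported functions, as a subspace of all functions. -/
def ccSubmodule : Submodule ℂ (G → ℂ) where
  carrier := {f | Continuous f ∧ HasCompactSupport f}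
  add_mem' hf hg := ⟨hf.1.add hg.1, hf.2.add hg.2⟩
  zero_mem' := ⟨continuous_const, HasCompactSupport.zero⟩
  smul_mem' z _ hf := ⟨hf.1.const_smul z, hf.2.comp_left (g := fun w => z • w) (smul_zero z)⟩

variable (G) in
/-- The convolution algebra `C_c(G)` of continuous compactly supported functions `G → ℂ`, with the
convolution product (not the pointwise one). -/
def Cc : Type u := ccSubmodule G

namespace Cc

noncomputable instance : AddCommGroup (Cc G) := inferInstanceAs (AddCommGroup (ccSubmodule G))

noncomputable instance : Module ℂ (Cc G) := inferInstanceAs (Module ℂ (ccSubmodule G))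

instance : CoeFun (Cc G) (fun _ => G → ℂ) := ⟨fun f => f.1⟩

@[ext] theorem ext {f g : Cc G} (h : ∀ c, f c = g c) : f = g := Subtype.ext (funext h)

theorem add_apply (f g : Cc G) (c : G) : (f + g) c = f c + g c := rfl

theorem smul_apply (z : ℂ) (f : Cc G) (c : G) : (z • f) c = z * f c := rfl

theorem coe_add (f g : Cc G) : (f + g).1 = f.1 + g.1 := rfl

theorem coe_smul (z : ℂ) (f : Cc G) : (z • f).1 = z • f.1 := rfl

theorem coe_zero : (0 : Cc G).1 = 0 := rfl

section

variable [IsAmple G]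

/-- The characteristic function `1_U` of a compact open subset. -/
noncomputable def char (U : Set G) (ho : IsOpen U) (hc : IsCompact U) : Cc G :=
  ⟨U.indicator (fun _ => 1), continuous_const.indicator
    (by simp [(show IsClopen U from ⟨hc.isClosed, ho⟩).frontier_eq]),
    HasCompactSupport.intro hc (fun _ hx => Set.indicator_of_notMem hx _)⟩

theorem finite_fiber (f : Cc G) (x : G) : {a | rng a = x ∧ f a ≠ 0}.Finite := by
  have hK : IsCompact (tsupport f.1 ∩ {a | rng a = x}) :=
    IsCompact.inter_right f.2.2 (isClosed_eq continuous_rng continuous_const)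
  have : (tsupport f.1 ∩ {a | rng a = x}).Finite := by
    apply hK.finite
    rw [isDiscrete_iff_nhdsWithin]
    rintro a ⟨hat, ha⟩
    obtain ⟨e, hae, he⟩ := IsAmple.isLocalHomeomorph_rng a
    apply le_antisymm
    · rw [Filter.le_pure_iff]
      filter_upwards [self_mem_nhdsWithin, mem_nhdsWithin_of_mem_nhds (e.open_source.mem_nhds hae)]
        with b hb hbe
      apply e.injOn hbe hae
      rw [← he]
      exact Subtype.ext (hb.2.trans (show rng a = x from ha).symm)
    · exact pure_le_nhdsWithin ⟨hat, ha⟩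
  exact this.subset fun a ha => ⟨subset_tsupport _ ha.2, ha.1⟩

theorem finite_support_conv (f : Cc G) (g : G → ℂ) (c : G) :
    (Function.support fun a : {a : G // rng a = rng c} => f a.1 * g (a.1⁻¹ * c)).Finite := by
  have h := (finite_fiber f (rng c)).preimage
    (f := (Subtype.val : {a : G // rng a = rng c} → G)) Subtype.val_injective.injOn
  refine h.subset ?_
  rintro ⟨a, ha⟩ h
  exact ⟨ha, left_ne_zero_of_mul h⟩

theorem conv_add_left (f₁ f₂ : Cc G) (g : G → ℂ) :
    conv (f₁ + f₂).1 g = conv f₁.1 g + conv f₂.1 g := by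
  funext c
  rw [Pi.add_apply, conv_eq, conv_eq, conv_eq,
    ← finsum_add_distrib (finite_support_conv f₁ g c) (finite_support_conv f₂ g c)]
  exact finsum_congr fun a => by rw [coe_add, Pi.add_apply, add_mul]

theorem conv_add_right (f : Cc G) (g₁ g₂ : G → ℂ) :
    conv f.1 (g₁ + g₂) = conv f.1 g₁ + conv f.1 g₂ := by
  funext c
  rw [Pi.add_apply, conv_eq, conv_eq, conv_eq,
    ← finsum_add_distrib (finite_support_conv f g₁ c) (finite_support_conv f g₂ c)]
  exact finsum_congr fun a => by rw [Pi.add_apply, mul_add]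

/-- Every element of `C_c(G)` is a finite sum of elements supported in compact open bisections. -/
theorem induction_bisection [CompactSpace (UnitSpace G)] {P : Cc G → Prop}
    (hadd : ∀ f g, P f → P g → P (f + g))
    (hbis : ∀ (S : Set G), IsOpen S → IsCompact S → IsBisection S →
      ∀ f : Cc G, Function.support f.1 ⊆ S → P f) (f : Cc G) : P f := by
  choose S h1 h2 h3 h4 using exists_compactOpen_bisection (G := G)
  obtain ⟨t, ht⟩ := IsCompact.elim_finite_subcover (s := tsupport f.1) f.2.2 S h2
    (fun g _ => Set.mem_iUnion.2 ⟨g, h1 g⟩)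
  have key : ∀ (t : Finset G) (f : Cc G), Function.support f.1 ⊆ ⋃ i ∈ t, S i → P f := by
    classical
    intro t
    induction t using Finset.induction_on with
    | empty =>
      intro f hf
      refine hbis ∅ isOpen_empty isCompact_empty ⟨by simp, by simp⟩ f ?_
      simpa using hf
    | insert i t hi ih =>
      intro f hf
      have hcl : IsClopen (S i) := ⟨(h3 i).isClosed, h2 i⟩
      have hsupp : ∀ A : Set G, HasCompactSupport (A.indicator f.1) := fun A =>
        HasCompactSupport.mono f.2.2 (by
          intro x hx
          exact fun h0 => hx (by rw [Set.indicator_apply, h0, ite_self]))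
      let f₁ : Cc G := ⟨(S i).indicator f.1,
        f.2.1.indicator (by simp [hcl.frontier_eq]), hsupp _⟩
      let f₂ : Cc G := ⟨(S i)ᶜ.indicator f.1,
        f.2.1.indicator (by simp [hcl.frontier_eq]), hsupp _⟩
      have hf12 : f = f₁ + f₂ :=
        Subtype.ext (Set.indicator_self_add_compl (S i) f.1).symm
      rw [hf12]
      apply hadd
      · exact hbis (S i) (h2 i) (h3 i) (h4 i) f₁ Set.support_indicator_subset
      · apply ih
        intro x hx
        have hx' : x ∈ (S i)ᶜ ∩ Function.support f.1 := by
          rw [← Set.support_indicator]; exact hx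
        have := hf hx'.2
        rw [Finset.set_biUnion_insert] at this
        exact this.resolve_left hx'.1
  exact key t f ((subset_tsupport _).trans ht)

theorem conv_mem [CompactSpace (UnitSpace G)] (f g : Cc G) : conv f.1 g.1 ∈ ccSubmodule G := by
  induction f using induction_bisection with
  | hadd f₁ f₂ h₁ h₂ =>
    rw [conv_add_left]
    exact (ccSubmodule G).add_mem h₁ h₂
  | hbis S ho hc hS f hf =>
    constructor
    · rw [continuous_iff_continuousAt]
      intro c
      by_cases hex : ∃ a ∈ S, rng a = rng c
      · obtain ⟨a, ha, hac⟩ := hex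
        obtain ⟨τ, h1, h2, h3⟩ := exists_section ho ha hac
        have h4 := continuousAt_inv_mul h2 (h3.mono fun _ h => h.2)
        have h5 : ContinuousAt (fun d => f (τ d) * g ((τ d)⁻¹ * d)) c :=
          (ContinuousAt.comp (g := f.1) f.2.1.continuousAt h2).mul
            (ContinuousAt.comp (g := g.1) (f := fun d => (τ d)⁻¹ * d) g.2.1.continuousAt h4)
        refine h5.congr ?_
        filter_upwards [h3] with d hd
        exact (conv_eq_of_mem hS.1 hf _ hd.1 hd.2).symm
      · have hcl : IsClosed (rng ⁻¹' (rng '' S)) :=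
          (hc.image continuous_rng).isClosed.preimage continuous_rng
        have h1 : ∀ᶠ d in nhds c, d ∉ rng ⁻¹' (rng '' S) :=
          hcl.isOpen_compl.mem_nhds hex
        refine (continuousAt_const (y := (0 : ℂ))).congr ?_
        filter_upwards [h1] with d hd
        exact (conv_eq_zero hf _ (fun a ha h => hd ⟨a, ha, h⟩)).symm
    · refine HasCompactSupport.intro (isCompact_setMul hc g.2.2) ?_
      intro c hcn
      by_cases hex : ∃ a ∈ S, rng a = rng c
      · obtain ⟨a, ha, hac⟩ := hex
        rw [conv_eq_of_mem hS.1 hf _ ha hac]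
        by_cases h0 : g (a⁻¹ * c) = 0
        · rw [h0, mul_zero]
        · exact absurd ⟨a, ha, _, subset_tsupport _ h0, by
            rw [rng_mul _ _ (by rw [src_inv, hac]), rng_inv], mul_inv_cancel_left' hac⟩ hcn
      · push Not at hex
        exact conv_eq_zero hf _ hex

theorem involution_mem (f : Cc G) : involution f.1 ∈ ccSubmodule G := by
  constructor
  · exact Complex.continuous_conj.comp (f.2.1.comp continuous_inv)
  · refine HasCompactSupport.intro (IsCompact.image f.2.2 continuous_inv) ?_
    intro c hc
    have : f c⁻¹ = 0 := by
      by_contra h0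
      exact hc ⟨c⁻¹, subset_tsupport _ h0, inv_inv' c⟩
    simp [involution, this]

noncomputable instance : StarAddMonoid (Cc G) where
  star f := ⟨involution f.1, involution_mem f⟩
  star_involutive f := Cc.ext fun c => by
    show (starRingEnd ℂ) ((starRingEnd ℂ) (f c⁻¹⁻¹)) = f c
    rw [inv_inv', Complex.conj_conj]
  star_add f g := Cc.ext fun c => map_add (starRingEnd ℂ) (f c⁻¹) (g c⁻¹)

theorem coe_star (f : Cc G) : (star f).1 = involution f.1 := rfl

variable [CompactSpace (UnitSpace G)]

noncomputable instance : Mul (Cc G) := ⟨fun f g => ⟨conv f.1 g.1, conv_mem f g⟩⟩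

noncomputable instance : One (Cc G) := ⟨char (unitSet G) isOpen_unitSet isCompact_unitSet⟩

theorem coe_mul (f g : Cc G) : (f * g).1 = conv f.1 g.1 := rfl

theorem coe_one : (1 : Cc G).1 = (unitSet G).indicator (fun _ => 1) := rfl

theorem one_mul_aux (f : Cc G) : 1 * f = f := by
  refine Cc.ext fun c => ?_
  show conv ((unitSet G).indicator (fun _ => 1)) f.1 c = f c
  rw [conv_eq_of_mem (S := unitSet G) unitSet_bisection.1 Set.support_indicator_subset f.1
    (a := rng c) (src_rng c) (rng_rng c), Set.indicator_of_mem (show rng c ∈ unitSet G from src_rng c),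
    one_mul, inv_of_src (src_rng c), rng_gmul]

theorem star_one_aux : star (1 : Cc G) = 1 := by
  refine Cc.ext fun c => ?_
  show (starRingEnd ℂ) ((unitSet G).indicator (fun _ => 1) c⁻¹) =
    (unitSet G).indicator (fun _ => 1) c
  by_cases h : c ∈ unitSet G
  · rw [inv_of_src h, Set.indicator_of_mem h, map_one]
  · have h' : c⁻¹ ∉ unitSet G := fun h' => h (by
      have := inv_of_src h'
      rw [inv_inv'] at this
      rw [this]; exact h')
    rw [Set.indicator_of_notMem h, Set.indicator_of_notMem h', map_zero]

theorem star_mul_aux (f g : Cc G) : star (f * g) = star g * star f :=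
  Subtype.ext (involution_conv f.1 g.1)

noncomputable instance : Ring (Cc G) where
  __ := (inferInstance : AddCommGroup (Cc G))
  __ := (inferInstance : Mul (Cc G))
  __ := (inferInstance : One (Cc G))
  left_distrib f g h := Subtype.ext (conv_add_right f g.1 h.1)
  right_distrib f g h := Subtype.ext (conv_add_left f g h.1)
  zero_mul f := Subtype.ext (by
    have := conv_smul_left 0 f.1 f.1
    rw [zero_smul, zero_smul] at this
    exact this)
  mul_zero f := Subtype.ext (by
    have := conv_smul_right 0 f.1 f.1
    rw [zero_smul, zero_smul] at this
    exact this)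
  mul_assoc f g h := by
    induction f using induction_bisection with
    | hadd f₁ f₂ h₁ h₂ =>
      have hd : ∀ a b c : Cc G, (a + b) * c = a * c + b * c :=
        fun a b c => Subtype.ext (conv_add_left a b c.1)
      rw [hd, hd, h₁, h₂, hd]
    | hbis S ho hc hS f hf => exact Subtype.ext (conv_assoc_of_support hS.1 hf g.1 h.1)
  one_mul := one_mul_aux
  mul_one f := by
    have := congrArg star (one_mul_aux (star f))
    rwa [star_mul_aux, star_star, star_one_aux] at this

noncomputable instance : StarRing (Cc G) where
  __ := (inferInstance : StarAddMonoid (Cc G))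
  star_mul := star_mul_aux

noncomputable instance : Algebra ℂ (Cc G) :=
  Algebra.ofModule (fun z f g => Subtype.ext (conv_smul_left z f.1 g.1))
    (fun z f g => Subtype.ext (conv_smul_right z f.1 g.1))

instance : StarModule ℂ (Cc G) where
  star_smul z f := Cc.ext fun c => map_mul (starRingEnd ℂ) z (f c⁻¹)

end

end Cc

end Convolution

section FullCStarAlgebra

variable (G : Type u) [TopologicalSpace G] [TopologicalGroupoid G] [IsAmple G]
  [CompactSpace (UnitSpace G)]

/-- A `*`-representation of `C_c(G)` by bounded operators on a Hilbert space. -/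
structure StarRep where
  H : Type u
  [normedAddCommGroup : NormedAddCommGroup H]
  [innerProductSpace : InnerProductSpace ℂ H]
  [completeSpace : CompleteSpace H]
  toHom : Cc G →⋆ₙₐ[ℂ] (H →L[ℂ] H)

attribute [instance] StarRep.normedAddCommGroup StarRep.innerProductSpace StarRep.completeSpace

variable {G}

namespace Cc

/-- Extension by zero of continuous functions on the (compact open) unit space. -/
noncomputable def ofUnits : C(UnitSpace G, ℂ) →⋆ₙₐ[ℂ] Cc G where
  toFun h := ⟨(unitSet G).indicator (fun g => h (srcMap g)),
    (h.continuous.comp IsAmple.isLocalHomeomorph_src.continuous).indicator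
      (by simp [isClopen_unitSet.frontier_eq]),
    HasCompactSupport.intro isCompact_unitSet (fun _ hx => Set.indicator_of_notMem hx _)⟩
  map_smul' z h := Cc.ext fun c => by
    show (unitSet G).indicator (fun g => (z • h) (srcMap g)) c =
      z * (unitSet G).indicator (fun g => h (srcMap g)) c
    by_cases hc : c ∈ unitSet G <;> simp [hc]
  map_zero' := Cc.ext fun c => by
    show (unitSet G).indicator (fun g => (0 : C(UnitSpace G, ℂ)) (srcMap g)) c = 0
    by_cases hc : c ∈ unitSet G <;> simp [hc]
  map_add' h k := Cc.ext fun c => by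
    show (unitSet G).indicator (fun g => (h + k) (srcMap g)) c =
      (unitSet G).indicator (fun g => h (srcMap g)) c +
      (unitSet G).indicator (fun g => k (srcMap g)) c
    by_cases hc : c ∈ unitSet G <;> simp [hc]
  map_mul' h k := Cc.ext fun c => by
    refine Eq.trans ?_ (conv_eq_of_mem (S := unitSet G) unitSet_bisection.1
      Set.support_indicator_subset _ (a := rng c) (src_rng c) (rng_rng c)).symm
    rw [Set.indicator_of_mem (show rng c ∈ unitSet G from src_rng c), inv_of_src (src_rng c),
      rng_gmul]
    by_cases hc : c ∈ unitSet G
    · simp only [Set.indicator_of_mem hc, ContinuousMap.mul_apply]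
      rw [rng_of_src hc]
    · simp only [Set.indicator_of_notMem hc, mul_zero]
  map_star' h := Cc.ext fun c => by
    show (unitSet G).indicator (fun g => (star h) (srcMap g)) c =
      (starRingEnd ℂ) ((unitSet G).indicator (fun g => h (srcMap g)) c⁻¹)
    by_cases hc : c ∈ unitSet G
    · rw [inv_of_src hc, Set.indicator_of_mem hc, Set.indicator_of_mem hc]
      rfl
    · have hc' : c⁻¹ ∉ unitSet G := fun h' => hc (by
        have := inv_of_src h'
        rw [inv_inv'] at this
        rw [this]; exact h')
      rw [Set.indicator_of_notMem hc, Set.indicator_of_notMem hc', map_zero]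

theorem exists_bound (f : Cc G) : ∃ C : ℝ, ∀ φ : StarRep G, ‖φ.toHom f‖ ≤ C := by
  induction f using induction_bisection with
  | hadd f g hf hg =>
    obtain ⟨C, hC⟩ := hf
    obtain ⟨D, hD⟩ := hg
    exact ⟨C + D, fun φ => by
      rw [map_add]
      exact (norm_add_le _ _).trans (add_le_add (hC φ) (hD φ))⟩
  | hbis S ho hc hS f hf =>
    let h : C(UnitSpace G, ℂ) :=
      ⟨fun x => (star f * f) x.1, (star f * f).2.1.comp continuous_subtype_val⟩
    have hfh : star f * f = ofUnits h := by
      refine Cc.ext fun c => ?_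
      by_cases hcu : c ∈ unitSet G
      · refine Eq.trans ?_
          (Set.indicator_of_mem hcu (fun g => h (srcMap g))).symm
        show (star f * f) c = (star f * f) (src c)
        rw [show src c = c from hcu]
      · refine Eq.trans ?_
          (Set.indicator_of_notMem hcu (fun g => h (srcMap g))).symm
        refine finsum_eq_zero_of_forall_eq_zero ?_
        rintro ⟨⟨a, b⟩, h1, h2⟩
        simp only at h1 h2 ⊢
        by_contra hne
        apply hcu
        have ha : f a⁻¹ ≠ 0 := fun h0 => left_ne_zero_of_mul hne (by
          show (starRingEnd ℂ) (f a⁻¹) = 0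
          rw [h0, map_zero])
        have hab : a⁻¹ = b := hS.1 (hf ha) (hf (right_ne_zero_of_mul hne)) (by rw [rng_inv, h1])
        show src c = c
        rw [← h2, ← hab, gmul_inv, src_rng]
    refine ⟨Real.sqrt ‖h‖, fun φ => Real.le_sqrt_of_sq_le ?_⟩
    have h1 : ‖φ.toHom f‖ ^ 2 = ‖φ.toHom (star f * f)‖ := by
      rw [map_mul, map_star, CStarRing.norm_star_mul_self, sq]
    rw [h1, hfh]
    exact NonUnitalStarAlgHom.norm_apply_le (φ.toHom.comp ofUnits) h

theorem bddAbove_norm (f : Cc G) :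
    BddAbove (Set.range fun φ : StarRep G => ‖φ.toHom f‖) := by
  obtain ⟨C, hC⟩ := exists_bound f
  exact ⟨C, by rintro _ ⟨φ, rfl⟩; exact hC φ⟩

instance : Nonempty (StarRep G) :=
  ⟨{ H := EuclideanSpace ℂ PEmpty.{u+1}, toHom := 0 }⟩

/-- The full norm `‖f‖ = sup ‖φ(f)‖` on `C_c(G)`, over all `*`-representations `φ`. (It is enough to
let the Hilbert spaces range over the universe of `G`, since that contains all cyclic
`*`-representations up to unitary equivalence.) -/
noncomputable instance : Norm (Cc G) := ⟨fun f => ⨆ φ : StarRep G, ‖φ.toHom f‖⟩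

theorem norm_def (f : Cc G) : ‖f‖ = ⨆ φ : StarRep G, ‖φ.toHom f‖ := rfl

theorem norm_rep_le (φ : StarRep G) (f : Cc G) : ‖φ.toHom f‖ ≤ ‖f‖ :=
  le_ciSup (bddAbove_norm f) φ

theorem norm_nonneg' (f : Cc G) : 0 ≤ ‖f‖ := Real.iSup_nonneg fun _ => norm_nonneg _

noncomputable instance : SeminormedRing (Cc G) :=
  { (inferInstance : Ring (Cc G)), (inferInstance : Norm (Cc G)),
    SeminormedAddCommGroup.ofCore (𝕜 := ℂ) (E := Cc G)
      { norm_nonneg := norm_nonneg'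
        norm_smul := fun z f => by
          simp only [norm_def, map_smul, norm_smul]
          rw [Real.mul_iSup_of_nonneg (norm_nonneg z)]
        norm_triangle := fun f g => ciSup_le fun φ => by
          rw [map_add]
          exact (norm_add_le _ _).trans (add_le_add (norm_rep_le φ f) (norm_rep_le φ g)) } with
    norm_mul_le := fun f g => ciSup_le fun φ => by
      rw [map_mul]
      exact (norm_mul_le _ _).trans
        (mul_le_mul (norm_rep_le φ f) (norm_rep_le φ g) (norm_nonneg _) (norm_nonneg' f)) }

noncomputable instance : NormedAlgebra ℂ (Cc G) where
  norm_smul_le z f := ciSup_le fun φ => by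
    rw [map_smul, norm_smul]
    exact mul_le_mul_of_nonneg_left (norm_rep_le φ f) (norm_nonneg z)

theorem norm_star' (f : Cc G) : ‖star f‖ = ‖f‖ := by
  simp only [norm_def, map_star, norm_star]

theorem norm_mul_self_le' (f : Cc G) : ‖f‖ * ‖f‖ ≤ ‖star f * f‖ := by
  have h : ‖f‖ ≤ Real.sqrt ‖star f * f‖ := ciSup_le fun φ => by
    apply Real.le_sqrt_of_sq_le
    have h1 : ‖φ.toHom f‖ ^ 2 = ‖φ.toHom (star f * f)‖ := by
      rw [map_mul, map_star, CStarRing.norm_star_mul_self, sq]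
    rw [h1]
    exact norm_rep_le φ _
  calc ‖f‖ * ‖f‖ ≤ Real.sqrt ‖star f * f‖ * Real.sqrt ‖star f * f‖ :=
        mul_self_le_mul_self (norm_nonneg' f) h
    _ = ‖star f * f‖ := Real.mul_self_sqrt (norm_nonneg' _)

theorem uniformContinuous_star : UniformContinuous (star : Cc G → Cc G) :=
  (AddMonoidHomClass.isometry_of_norm (starAddEquiv (R := Cc G)) norm_star').uniformContinuous

end Cc

variable (G) in
/-- The full groupoid C*-algebra `C*(G)`: the (Hausdorff) completion of `C_c(G)` for the full
norm. -/
def FullCStar : Type u := UniformSpace.Completion (Cc G)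

namespace FullCStar

open UniformSpace

noncomputable instance : NormedRing (FullCStar G) :=
  inferInstanceAs (NormedRing (Completion (Cc G)))

instance : CompleteSpace (FullCStar G) :=
  inferInstanceAs (CompleteSpace (Completion (Cc G)))

noncomputable instance : NormedAlgebra ℂ (FullCStar G) :=
  { (inferInstance : Algebra ℂ (Completion (Cc G))),
    (inferInstance : NormedSpace ℂ (Completion (Cc G))) with }

/-- The canonical map `C_c(G) → C*(G)`. -/
noncomputable def of (f : Cc G) : FullCStar G := (f : Completion (Cc G))

theorem of_add (f g : Cc G) : of (f + g) = of f + of g := Completion.coe_add f g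
theorem of_mul (f g : Cc G) : of (f * g) = of f * of g := Completion.coe_mul f g
theorem of_one : of (1 : Cc G) = 1 := rfl
theorem of_smul (z : ℂ) (f : Cc G) : of (z • f) = z • of f := Completion.coe_smul z f
theorem norm_of (f : Cc G) : ‖of f‖ = ‖f‖ := Completion.norm_coe f

theorem continuous_of : Continuous (of : Cc G → FullCStar G) := Completion.continuous_coe _

theorem denseRange_of : DenseRange (of : Cc G → FullCStar G) := Completion.denseRange_coe

/-- The involution of `C*(G)`, extended by continuity from `C_c(G)`. -/
noncomputable instance : Star (FullCStar G) :=
  ⟨Completion.map (star : Cc G → Cc G)⟩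

theorem continuous_star' : Continuous (star : FullCStar G → FullCStar G) :=
  Completion.continuous_map

theorem of_star (f : Cc G) : of (star f) = star (of f) :=
  (Completion.map_coe Cc.uniformContinuous_star f).symm

noncomputable instance : StarRing (FullCStar G) where
  star_involutive x := by
    induction x using denseRange_of.induction_on with
    | hp =>
      exact isClosed_eq (continuous_star'.comp continuous_star') continuous_id
    | ih f => rw [← of_star, ← of_star, star_star]
  star_mul x y := by
    induction x, y using denseRange_of.induction_on₂ with
    | hp =>
      exact isClosed_eq (continuous_star'.comp continuous_mul)
        ((continuous_star'.comp continuous_snd).mul (continuous_star'.comp continuous_fst))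
    | h f g => rw [← of_mul, ← of_star, ← of_star, ← of_star, ← of_mul, star_mul]
  star_add x y := by
    induction x, y using denseRange_of.induction_on₂ with
    | hp =>
      exact isClosed_eq (continuous_star'.comp continuous_add)
        ((continuous_star'.comp continuous_fst).add (continuous_star'.comp continuous_snd))
    | h f g => rw [← of_add, ← of_star, ← of_star, ← of_star, ← of_add, star_add]

noncomputable instance : CStarAlgebra (FullCStar G) where
  norm_mul_self_le x := by
    induction x using denseRange_of.induction_on with
    | hp =>
      exact isClosed_le (continuous_norm.mul continuous_norm)
        (continuous_norm.comp (continuous_star'.mul continuous_id))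
    | ih f =>
      rw [← of_star, ← of_mul, norm_of, norm_of]
      exact Cc.norm_mul_self_le' f
  star_smul z x := by
    induction x using denseRange_of.induction_on with
    | hp =>
      exact isClosed_eq (continuous_star'.comp (continuous_const_smul z))
        ((continuous_const_smul (star z)).comp continuous_star')
    | ih f => rw [← of_smul, ← of_star, ← of_star, ← of_smul, star_smul]

end FullCStar

end FullCStarAlgebra

section FullGroup

variable (G : Type u) [TopologicalSpace G] [TopologicalGroupoid G]

/-- The topological full group `[[G]]`: the compact open bisections `U` with
`r(U) = s(U) = G⁽⁰⁾`. -/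
@[ext] structure TopFullGroup where
  carrier : Set G
  isOpen : IsOpen carrier
  isCompact : IsCompact carrier
  isBisection : IsBisection carrier
  rng_image : rng '' carrier = unitSet G
  src_image : src '' carrier = unitSet G

variable {G}

namespace TopFullGroup

instance : Membership G (TopFullGroup G) := ⟨fun U g => g ∈ U.carrier⟩

theorem exists_rng (U : TopFullGroup G) (g : G) : ∃ a ∈ U.carrier, rng a = rng g := by
  have : rng g ∈ rng '' U.carrier := by rw [U.rng_image]; exact src_rng g
  exact this

theorem exists_src (U : TopFullGroup G) (g : G) : ∃ a ∈ U.carrier, src a = src g := by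
  have : src g ∈ src '' U.carrier := by rw [U.src_image]; exact src_src g
  exact this

theorem exists_src_eq (U : TopFullGroup G) (x : UnitSpace G) : ∃ a ∈ U.carrier, srcMap a = x := by
  obtain ⟨a, ha, h⟩ := U.exists_src x.1
  exact ⟨a, ha, Subtype.ext (h.trans x.2)⟩

variable [IsAmple G]

instance : Mul (TopFullGroup G) where
  mul U V :=
    { carrier := setMul U.carrier V.carrier
      isOpen := isOpen_setMul U.isOpen V.isOpen
      isCompact := isCompact_setMul U.isCompact V.isCompact
      isBisection := by
        constructor
        · rintro _ ⟨a, ha, b, hb, h, rfl⟩ _ ⟨a', ha', b', hb', h', rfl⟩ he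
          rw [rng_mul _ _ h, rng_mul _ _ h'] at he
          obtain rfl := U.isBisection.1 ha ha' he
          rw [V.isBisection.1 hb hb' (h.symm.trans h')]
        · rintro _ ⟨a, ha, b, hb, h, rfl⟩ _ ⟨a', ha', b', hb', h', rfl⟩ he
          rw [src_mul _ _ h, src_mul _ _ h'] at he
          obtain rfl := V.isBisection.2 hb hb' he
          rw [U.isBisection.2 ha ha' (h.trans h'.symm)]
      rng_image := by
        ext x
        constructor
        · rintro ⟨g, -, rfl⟩
          exact src_rng g
        · intro hx
          obtain ⟨a, ha, hax⟩ := U.exists_rng x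
          obtain ⟨b, hb, hab⟩ := V.exists_rng (src a)
          rw [rng_src] at hab
          exact ⟨a * b, ⟨a, ha, b, hb, hab.symm, rfl⟩, by
            rw [rng_mul _ _ hab.symm, hax, rng_of_src hx]⟩
      src_image := by
        ext x
        constructor
        · rintro ⟨g, -, rfl⟩
          exact src_src g
        · intro hx
          obtain ⟨b, hb, hbx⟩ := V.exists_src x
          obtain ⟨a, ha, hab⟩ := U.exists_src (rng b)
          rw [src_rng] at hab
          exact ⟨a * b, ⟨a, ha, b, hb, hab, rfl⟩, by
            rw [src_mul _ _ hab, hbx]; exact hx⟩ }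

instance : Inv (TopFullGroup G) where
  inv U :=
    { carrier := {g | g⁻¹ ∈ U.carrier}
      isOpen := U.isOpen.preimage continuous_inv
      isCompact := by
        convert U.isCompact.image continuous_inv using 1
        ext g
        exact ⟨fun h => ⟨g⁻¹, h, inv_inv' g⟩, by
          rintro ⟨a, ha, rfl⟩
          show a⁻¹⁻¹ ∈ U.carrier
          rwa [inv_inv']⟩
      isBisection := by
        constructor
        · intro a ha b hb h
          rw [← inv_inv' a, U.isBisection.2 ha hb (by rw [src_inv, src_inv, h]), inv_inv']
        · intro a ha b hb h
          rw [← inv_inv' a, U.isBisection.1 ha hb (by rw [rng_inv, rng_inv, h]), inv_inv']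
      rng_image := by
        rw [← U.src_image]
        ext x
        constructor
        · rintro ⟨g, hg, rfl⟩
          exact ⟨g⁻¹, hg, src_inv g⟩
        · rintro ⟨g, hg, rfl⟩
          exact ⟨g⁻¹, show g⁻¹⁻¹ ∈ U.carrier by rwa [inv_inv'], rng_inv g⟩
      src_image := by
        rw [← U.rng_image]
        ext x
        constructor
        · rintro ⟨g, hg, rfl⟩
          exact ⟨g⁻¹, hg, rng_inv g⟩
        · rintro ⟨g, hg, rfl⟩
          exact ⟨g⁻¹, show g⁻¹⁻¹ ∈ U.carrier by rwa [inv_inv'], src_inv g⟩ }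

variable [CompactSpace (UnitSpace G)]

instance : One (TopFullGroup G) where
  one :=
    { carrier := unitSet G
      isOpen := isOpen_unitSet
      isCompact := isCompact_unitSet
      isBisection := unitSet_bisection
      rng_image := by
        ext x
        exact ⟨by rintro ⟨g, -, rfl⟩; exact src_rng g, fun h => ⟨x, h, rng_of_src h⟩⟩
      src_image := by
        ext x
        exact ⟨by rintro ⟨g, -, rfl⟩; exact src_src g, fun h => ⟨x, h, h⟩⟩ }

theorem carrier_mul (U V : TopFullGroup G) : (U * V).carrier = setMul U.carrier V.carrier := rfl

theorem carrier_one : (1 : TopFullGroup G).carrier = unitSet G := rfl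

theorem carrier_inv (U : TopFullGroup G) : (U⁻¹).carrier = {g | g⁻¹ ∈ U.carrier} := rfl

/-- `[[G]]` is a group under the product `U V` of bisections, with unit `G⁽⁰⁾` and inverse
`U⁻¹ = {g⁻¹ | g ∈ U}`. -/
instance : Group (TopFullGroup G) where
  mul_assoc U V W := by
    ext c
    constructor
    · rintro ⟨_, ⟨a, ha, b, hb, hab, rfl⟩, d, hd, h, rfl⟩
      rw [src_mul _ _ hab] at h
      exact ⟨a, ha, b * d, ⟨b, hb, d, hd, h, rfl⟩, by rw [rng_mul _ _ h, hab],
        (gmul_assoc _ _ _ hab h).symm⟩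
    · rintro ⟨a, ha, _, ⟨b, hb, d, hd, h, rfl⟩, hab, rfl⟩
      rw [rng_mul _ _ h] at hab
      exact ⟨a * b, ⟨a, ha, b, hb, hab, rfl⟩, d, hd, by rw [src_mul _ _ hab, h],
        gmul_assoc _ _ _ hab h⟩
  one_mul U := by
    ext c
    constructor
    · rintro ⟨a, ha, b, hb, h, rfl⟩
      rw [show a = rng b by rw [← h]; exact (show src a = a from ha).symm, rng_gmul]
      exact hb
    · intro hc
      exact ⟨rng c, src_rng c, c, hc, src_rng c, rng_gmul c⟩
  mul_one U := by
    ext c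
    constructor
    · rintro ⟨a, ha, b, hb, h, rfl⟩
      rw [show b = src a by rw [h, rng_of_src hb], gmul_src]
      exact ha
    · intro hc
      exact ⟨c, hc, src c, src_src c, (rng_src c).symm, gmul_src c⟩
  inv_mul_cancel U := by
    ext c
    constructor
    · rintro ⟨a, ha, b, hb, h, rfl⟩
      have : a⁻¹ = b := U.isBisection.1 ha hb (by rw [rng_inv, h])
      rw [← this, gmul_inv]
      exact src_rng a
    · intro hc
      obtain ⟨b, hb, hbc⟩ := U.exists_src c
      refine ⟨b⁻¹, show b⁻¹⁻¹ ∈ U.carrier by rwa [inv_inv'], b, hb, src_inv b, ?_⟩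
      rw [inv_gmul, hbc]
      exact hc

/-- The characteristic function `1_U ∈ C_c(G)` of `U ∈ [[G]]`. -/
noncomputable def charFn (U : TopFullGroup G) : Cc G :=
  Cc.char U.carrier U.isOpen U.isCompact

theorem charFn_one : charFn (1 : TopFullGroup G) = 1 := rfl

theorem charFn_mul (U V : TopFullGroup G) : charFn (U * V) = charFn U * charFn V := by
  refine Cc.ext fun c => ?_
  obtain ⟨a, ha, hac⟩ := U.exists_rng c
  refine Eq.trans ?_ (conv_eq_of_mem U.isBisection.1 Set.support_indicator_subset _ ha hac).symm
  show (U * V).carrier.indicator (fun _ => (1 : ℂ)) c =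
    U.carrier.indicator (fun _ => (1 : ℂ)) a * V.carrier.indicator (fun _ => (1 : ℂ)) (a⁻¹ * c)
  rw [Set.indicator_of_mem ha, one_mul]
  have key : c ∈ (U * V).carrier ↔ a⁻¹ * c ∈ V.carrier := by
    constructor
    · rintro ⟨a', ha', b, hb, h, rfl⟩
      rw [rng_mul _ _ h] at hac
      obtain rfl := U.isBisection.1 ha ha' hac
      rwa [inv_mul_cancel_left' h]
    · intro h
      exact ⟨a, ha, _, h, by rw [rng_mul _ _ (by rw [src_inv, hac]), rng_inv],
        mul_inv_cancel_left' hac⟩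
  by_cases h : a⁻¹ * c ∈ V.carrier
  · rw [Set.indicator_of_mem h, Set.indicator_of_mem (key.2 h)]
  · rw [Set.indicator_of_notMem h, Set.indicator_of_notMem (fun h' => h (key.1 h'))]

theorem charFn_inv (U : TopFullGroup G) : charFn U⁻¹ = star (charFn U) := by
  refine Cc.ext fun c => ?_
  show (U⁻¹).carrier.indicator (fun _ => (1 : ℂ)) c =
    (starRingEnd ℂ) (U.carrier.indicator (fun _ => (1 : ℂ)) c⁻¹)
  by_cases h : c⁻¹ ∈ U.carrier
  · rw [Set.indicator_of_mem h, Set.indicator_of_mem (show c ∈ (U⁻¹).carrier from h), map_one]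
  · rw [Set.indicator_of_notMem h,
      Set.indicator_of_notMem (show c ∉ (U⁻¹).carrier from h), map_zero]

variable (G) in
/-- The unitary representation `π : [[G]] → C*(G)`, `π(U) = 1_U`. -/
noncomputable def canonicalRep : TopFullGroup G →* unitary (FullCStar G) where
  toFun U := ⟨FullCStar.of (charFn U), by
    rw [Unitary.mem_iff, ← FullCStar.of_star, ← charFn_inv, ← FullCStar.of_mul,
      ← FullCStar.of_mul, ← charFn_mul, ← charFn_mul, inv_mul_cancel, mul_inv_cancel, charFn_one,
      FullCStar.of_one]
    exact ⟨rfl, rfl⟩⟩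
  map_one' := rfl
  map_mul' U V := Subtype.ext (by
    show FullCStar.of (charFn (U * V)) = FullCStar.of (charFn U) * FullCStar.of (charFn V)
    rw [charFn_mul, FullCStar.of_mul])

/-- The transformation `θ_U = r ∘ (s|_U)⁻¹` of the unit space. -/
noncomputable def theta (U : TopFullGroup G) (x : UnitSpace G) : UnitSpace G :=
  rngMap (Classical.choose (U.exists_src_eq x))

theorem theta_srcMap (U : TopFullGroup G) {a : G} (ha : a ∈ U.carrier) :
    U.theta (srcMap a) = rngMap a := by
  have h := Classical.choose_spec (U.exists_src_eq (srcMap a))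
  exact congrArg rngMap (U.isBisection.2 h.1 ha (congrArg Subtype.val h.2))

/-- A subgroup `Γ ≤ [[G]]` covers `G` if `G = ⋃_{U ∈ Γ} U`. -/
def Covers (Γ : Subgroup (TopFullGroup G)) : Prop := ∀ g : G, ∃ U ∈ Γ, g ∈ U.carrier

end TopFullGroup

end FullGroup

section Measures

variable {G : Type u} [TopologicalSpace G] [TopologicalGroupoid G] [IsAmple G]
  [CompactSpace (UnitSpace G)] [MeasurableSpace (UnitSpace G)]

/-- A measure on the unit space is `G`-invariant if `μ(r(S)) = μ(s(S))` for every open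
bisection `S`. -/
def IsGroupoidInvariant (μ : MeasureTheory.Measure (UnitSpace G)) : Prop :=
  ∀ S : Set G, IsOpen S → IsBisection S → μ (rngMap '' S) = μ (srcMap '' S)

/-- A measure on the unit space is `Γ`-invariant if `θ_U` preserves it for every `U ∈ Γ`. -/
def IsSubgroupInvariant (Γ : Subgroup (TopFullGroup G))
    (μ : MeasureTheory.Measure (UnitSpace G)) : Prop :=
  ∀ U ∈ Γ, MeasureTheory.MeasurePreserving U.theta μ μ

end Measures

section UnitaryRepresentations

variable {Γ : Type*} [Group Γ]

/-- The linear extension `∑ αᵢ gᵢ ↦ ∑ αᵢ σ(gᵢ)` of a unitary representation to `ℂΓ`. -/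
noncomputable def groupAlgebraMap {A : Type*} [CStarAlgebra A] (σ : Γ →* unitary A) :
    MonoidAlgebra ℂ Γ →ₐ[ℂ] A :=
  MonoidAlgebra.lift ℂ A Γ ((unitary A).subtype.comp σ)

/-- `σ` weakly contains `η` if `‖∑ αᵢ η(gᵢ)‖ ≤ ‖∑ αᵢ σ(gᵢ)‖` for every `∑ αᵢ gᵢ ∈ ℂΓ`. -/
def WeaklyContains {A B : Type*} [CStarAlgebra A] [CStarAlgebra B] (σ : Γ →* unitary A)
    (η : Γ →* unitary B) : Prop :=
  ∀ x : MonoidAlgebra ℂ Γ, ‖groupAlgebraMap η x‖ ≤ ‖groupAlgebraMap σ x‖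

variable (Γ) in
/-- The trivial representation `Γ → ℂ`, `g ↦ 1`. -/
def trivialRep : Γ →* unitary ℂ := 1

/-- The C*-algebra `C*_σ(Γ)` generated by the image of a unitary representation `σ`. -/
noncomputable def generatedCStar {A : Type*} [CStarAlgebra A] (σ : Γ →* unitary A) :
    StarSubalgebra ℂ A :=
  (StarAlgebra.adjoin ℂ (Set.range fun g => (σ g : A))).topologicalClosure

/-- `C*_σ(Γ)` admits a character, that is, a nonzero multiplicative linear functional. -/
def HasCharacter {A : Type*} [CStarAlgebra A] (σ : Γ →* unitary A) : Prop :=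
  (WeakDual.characterSpace ℂ (generatedCStar σ)).Nonempty

end UnitaryRepresentations

end TopologicalGroupoid

namespace TopologicalGroupoid

open MeasureTheory
open scoped ComplexOrder InnerProductSpace

/-! An invariant measure μ lets C_c(G) act on L²(μ) by (fξ)(x) = ∑_{r(a)=x} f(a) ξ(s(a)). Invariance
is exactly what makes this a *-representation: on an open bisection S, the measures pulled back
along r and along s agree (`IsGroupoidInvariant.integral_act_star`). Each 1_U with U ∈ [[G]] fixes
the constant function 1 (`Cc.act_charFn`), so ∑ αᵢ gᵢ acts on it as the scalar ∑ αᵢ. The full norm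
dominates the norm of this representation, whence (1) ⇒ (2).

Condition (2) says that the augmentation ℂΓ → ℂ is bounded for the norm of C*(G). It therefore
extends by continuity to a multiplicative functional, which gives (3).

A character of C*_π(Γ) extends by Hahn–Banach to a state φ on C*(G). It has modulus one on each
unitary π(U), so Cauchy–Schwarz makes φ invariant under conjugation by π(U) (`apply_conj_unitary`).
On C(G⁽⁰⁾) this conjugation is composition with θ_U or its inverse (`ofUnits_mul_charFn`), so the
measure representing φ on C(G⁽⁰⁾) is Γ-invariant, which is (4).

If Γ covers G, a compact subset of an open bisection splits into finitely many pieces, each inside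
some U ∈ Γ, and θ_U matches the measures of their ranges and sources. Inner regularity passes from
compact sets to the whole bisection (`IsSubgroupInvariant.isGroupoidInvariant`), giving (1). -/

theorem isOpenEmbedding_domRestrict {G X : Type*} [TopologicalSpace G] [TopologicalSpace X]
    {p : G → X} (hp : IsLocalHomeomorph p) {S : Set G} (hS : IsOpen S) (hinj : Set.InjOn p S) :
    Topology.IsOpenEmbedding (S.domRestrict p) :=
  (hp.comp hS.isOpenEmbedding_subtypeVal.isLocalHomeomorph).isOpenEmbedding_of_injective
    hinj.injective

/-! ### The homeomorphisms θ_U of the unit space -/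

section Theta

variable {G : Type u} [TopologicalSpace G] [TopologicalGroupoid G] [IsAmple G]

theorem continuous_rngMap : Continuous (rngMap : G → UnitSpace G) :=
  IsAmple.isLocalHomeomorph_rng.continuous

theorem continuous_srcMap : Continuous (srcMap : G → UnitSpace G) :=
  IsAmple.isLocalHomeomorph_src.continuous

variable [CompactSpace (UnitSpace G)]

namespace TopFullGroup

/-- For closed C the right-hand side is the image of a compact set, hence closed; this is how
continuity of θ_U is obtained. -/
theorem preimage_theta (U : TopFullGroup G) (C : Set (UnitSpace G)) :
    U.theta ⁻¹' C = srcMap '' (U.carrier ∩ rngMap ⁻¹' C) := by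
  ext x
  obtain ⟨a, ha, rfl⟩ := U.exists_src_eq x
  rw [Set.mem_preimage, U.theta_srcMap ha]
  constructor
  · intro h
    exact ⟨a, ⟨ha, h⟩, rfl⟩
  · rintro ⟨b, ⟨hb, hbC⟩, hba⟩
    rwa [← U.isBisection.2 hb ha (congrArg Subtype.val hba)]

theorem continuous_theta (U : TopFullGroup G) : Continuous U.theta := by
  rw [continuous_iff_isClosed]
  intro C hC
  rw [preimage_theta]
  exact ((U.isCompact.inter_right (hC.preimage continuous_rngMap)).image
    continuous_srcMap).isClosed

theorem theta_injective (U : TopFullGroup G) : Function.Injective U.theta := by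
  intro x y h
  obtain ⟨a, ha, rfl⟩ := U.exists_src_eq x
  obtain ⟨b, hb, rfl⟩ := U.exists_src_eq y
  rw [U.theta_srcMap ha, U.theta_srcMap hb] at h
  rw [U.isBisection.1 ha hb (congrArg Subtype.val h)]

theorem theta_surjective (U : TopFullGroup G) : Function.Surjective U.theta := by
  intro y
  obtain ⟨a, ha, hay⟩ := U.exists_rng y.1
  exact ⟨srcMap a, (U.theta_srcMap ha).trans (Subtype.ext (hay.trans (rng_of_src y.2)))⟩

/-- The transformation `θ_U` as a homeomorphism of the unit space. -/
noncomputable def thetaHomeomorph (U : TopFullGroup G) : UnitSpace G ≃ₜ UnitSpace G :=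
  U.continuous_theta.homeoOfEquivCompactToT2
    (f := Equiv.ofBijective U.theta ⟨U.theta_injective, U.theta_surjective⟩)

end TopFullGroup

end Theta

/-! ### From Γ-invariance to G-invariance when Γ covers G -/

section Covering

variable {G : Type u} [TopologicalSpace G] [TopologicalGroupoid G] [IsAmple G]
  [CompactSpace (UnitSpace G)] [MeasurableSpace (UnitSpace G)] [BorelSpace (UnitSpace G)]

/-- Within a single U ∈ Γ, injectivity of r on U gives θ_U⁻¹(r(L)) = s(L), and θ_U preserves μ.
Compactness of L is there to make r(L) measurable. -/
theorem IsSubgroupInvariant.measure_image_eq_of_subset {Γ : Subgroup (TopFullGroup G)}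
    {μ : Measure (UnitSpace G)} (hμ : IsSubgroupInvariant Γ μ) {U : TopFullGroup G} (hU : U ∈ Γ)
    {L : Set G} (hL : IsCompact L) (hLU : L ⊆ U.carrier) :
    μ (rngMap '' L) = μ (srcMap '' L) := by
  rw [← (hμ U hU).measure_preimage
    (hL.image continuous_rngMap).isClosed.measurableSet.nullMeasurableSet, U.preimage_theta]
  congr 2
  ext a
  constructor
  · rintro ⟨ha, b, hb, hba⟩
    rwa [← U.isBisection.1 (hLU hb) ha (congrArg Subtype.val hba)]
  · exact fun ha => ⟨hLU ha, a, ha, rfl⟩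

/-- By induction on t, L is cut into L ∩ U and L \ U. Both pieces stay compact because U is clopen,
and since L is a bisection their images under r, and under s, are disjoint, so measures add up. -/
theorem IsSubgroupInvariant.measure_image_eq_of_subset_biUnion {Γ : Subgroup (TopFullGroup G)}
    {μ : Measure (UnitSpace G)} (hμ : IsSubgroupInvariant Γ μ) (t : Finset (TopFullGroup G))
    (ht : ∀ U ∈ t, U ∈ Γ) {L : Set G} (hL : IsCompact L) (hbis : IsBisection L)
    (hLt : L ⊆ ⋃ U ∈ t, U.carrier) :
    μ (rngMap '' L) = μ (srcMap '' L) := by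
  classical
  induction t using Finset.induction_on generalizing L with
  | empty =>
    have : L = ∅ := by simpa using hLt
    simp [this]
  | insert U t hUt ih =>
    have h1 : IsCompact (L ∩ U.carrier) := hL.inter_right U.isCompact.isClosed
    have h2 : IsCompact (L \ U.carrier) := hL.diff U.isOpen
    have h3 : μ (rngMap '' (L \ U.carrier)) = μ (srcMap '' (L \ U.carrier)) := by
      refine ih (fun V hV => ht V (Finset.mem_insert_of_mem hV)) h2
        ⟨hbis.1.mono Set.sdiff_subset, hbis.2.mono Set.sdiff_subset⟩ ?_
      rintro a ⟨haL, haU⟩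
      have := hLt haL
      rw [Finset.set_biUnion_insert] at this
      exact this.resolve_left haU
    have h4 := hμ.measure_image_eq_of_subset (ht U (Finset.mem_insert_self U t)) h1
      Set.inter_subset_right
    have hr : Set.InjOn (rngMap : G → UnitSpace G) L :=
      fun a ha b hb h => hbis.1 ha hb (congrArg Subtype.val h)
    have hs : Set.InjOn (srcMap : G → UnitSpace G) L :=
      fun a ha b hb h => hbis.2 ha hb (congrArg Subtype.val h)
    have key : ∀ p : G → UnitSpace G, Continuous p → Set.InjOn p L →
        μ (p '' L) = μ (p '' (L ∩ U.carrier)) + μ (p '' (L \ U.carrier)) := by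
      intro p hp hinj
      rw [← measure_union _ (h2.image hp).isClosed.measurableSet, ← Set.image_union,
        Set.inter_union_sdiff]
      exact Set.disjoint_image_image fun a ha b hb h =>
        hb.2 (hinj ha.1 hb.1 h ▸ ha.2)
    rw [key _ continuous_rngMap hr, key _ continuous_srcMap hs, h3, h4]

/-- A compact K ⊆ p(S) lifts through the homeomorphism S → p(S) to a compact L ⊆ S with p(L) = K, so
inner regularity on p(S) suffices. The inequality is one-sided so that it can be applied twice, with
the roles of r and s exchanged. -/
theorem measure_image_le_of_isCompact {μ : Measure (UnitSpace G)} [μ.Regular] {S : Set G}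
    {p q : G → UnitSpace G} (hp : IsLocalHomeomorph p) (hS : IsOpen S) (hinj : Set.InjOn p S)
    (h : ∀ L ⊆ S, IsCompact L → μ (p '' L) = μ (q '' L)) : μ (p '' S) ≤ μ (q '' S) := by
  have hpS : IsOpen (p '' S) := hp.isOpenMap S hS
  rw [hpS.measure_eq_iSup_isCompact]
  refine iSup₂_le fun K hK => iSup_le fun hKc => ?_
  have hemb := isOpenEmbedding_domRestrict hp hS hinj
  have hc : IsCompact ((S.domRestrict p) ⁻¹' K) :=
    hemb.toIsInducing.isCompact_preimage' hKc (by rw [Set.range_domRestrict]; exact hK)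
  have hL : IsCompact (Subtype.val '' ((S.domRestrict p) ⁻¹' K)) := hc.image continuous_subtype_val
  have hLS : Subtype.val '' ((S.domRestrict p) ⁻¹' K) ⊆ S := by
    rintro _ ⟨a, -, rfl⟩
    exact a.2
  have hLK : p '' (Subtype.val '' ((S.domRestrict p) ⁻¹' K)) = K := by
    ext x
    constructor
    · rintro ⟨_, ⟨a, ha, rfl⟩, rfl⟩
      exact ha
    · intro hx
      obtain ⟨a, ha, rfl⟩ := hK hx
      exact ⟨a, ⟨⟨a, ha⟩, hx, rfl⟩, rfl⟩
  rw [← hLK, h _ hLS hL]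
  exact measure_mono (Set.image_mono hLS)

/-- If `Γ` covers `G`, then a regular `Γ`-invariant measure is `G`-invariant. -/
theorem IsSubgroupInvariant.isGroupoidInvariant {Γ : Subgroup (TopFullGroup G)}
    {μ : Measure (UnitSpace G)} [μ.Regular] (hμ : IsSubgroupInvariant Γ μ)
    (hΓ : TopFullGroup.Covers Γ) : IsGroupoidInvariant μ := by
  intro S hS hbis
  have key : ∀ L ⊆ S, IsCompact L → μ (rngMap '' L) = μ (srcMap '' L) := by
    intro L hLS hL
    classical
    -- The members of Γ form an open cover of G, so finitely many of them cover L.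
    obtain ⟨t, ht⟩ := hL.elim_finite_subcover (fun U : Γ => U.1.carrier) (fun U => U.1.isOpen)
      (fun g _ => by
        obtain ⟨U, hU, hg⟩ := hΓ g
        exact Set.mem_iUnion.2 ⟨⟨U, hU⟩, hg⟩)
    refine hμ.measure_image_eq_of_subset_biUnion (t.image Subtype.val) ?_ hL
      ⟨hbis.1.mono hLS, hbis.2.mono hLS⟩ ?_
    · intro U hU
      obtain ⟨V, -, rfl⟩ := Finset.mem_image.1 hU
      exact V.2
    · intro a ha
      obtain ⟨U, hU, haU⟩ := Set.mem_iUnion₂.1 (ht ha)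
      exact Set.mem_iUnion₂.2 ⟨U.1, Finset.mem_image_of_mem _ hU, haU⟩
  exact le_antisymm
    (measure_image_le_of_isCompact IsAmple.isLocalHomeomorph_rng hS
      (fun a ha b hb h => hbis.1 ha hb (congrArg Subtype.val h)) key)
    (measure_image_le_of_isCompact IsAmple.isLocalHomeomorph_src hS
      (fun a ha b hb h => hbis.2 ha hb (congrArg Subtype.val h))
      fun L hLS hL => (key L hLS hL).symm)

end Covering

/-! ### Weak containment of the trivial representation and characters -/

section WeakContainment

variable {Γ : Type*} [Group Γ] {A : Type*} [CStarAlgebra A] (σ : Γ →* unitary A)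

theorem groupAlgebraMap_single (g : Γ) (z : ℂ) :
    groupAlgebraMap σ (MonoidAlgebra.single g z) = z • (σ g : A) := by
  rw [groupAlgebraMap, MonoidAlgebra.lift_single]
  rfl

theorem generator_mem (g : Γ) : (σ g : A) ∈ generatedCStar σ :=
  StarSubalgebra.le_topologicalClosure _ (StarAlgebra.subset_adjoin ℂ _ ⟨g, rfl⟩)

/-- The image of ℂΓ is already closed under the involution because σ(g)* = σ(g⁻¹). Hence it is dense
in C*_σ(Γ). -/
theorem adjoin_range_le :
    ((StarAlgebra.adjoin ℂ (Set.range fun g => (σ g : A)) : StarSubalgebra ℂ A) : Set A) ⊆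
      Set.range (groupAlgebraMap σ) := by
  intro a ha
  induction ha using StarAlgebra.adjoin_induction with
  | mem x hx =>
    obtain ⟨g, rfl⟩ := hx
    exact ⟨MonoidAlgebra.single g 1, by rw [groupAlgebraMap_single, one_smul]⟩
  | algebraMap z => exact ⟨algebraMap ℂ _ z, AlgHom.commutes _ z⟩
  | add x y _ _ hx hy =>
    obtain ⟨⟨x, rfl⟩, ⟨y, rfl⟩⟩ := hx, hy
    exact ⟨x + y, map_add _ x y⟩
  | mul x y _ _ hx hy =>
    obtain ⟨⟨x, rfl⟩, ⟨y, rfl⟩⟩ := hx, hy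
    exact ⟨x * y, map_mul _ x y⟩
  | star x hm hx =>
    obtain ⟨x, rfl⟩ := hx
    clear hm
    induction x using MonoidAlgebra.induction_linear with
    | zero => exact ⟨0, by simp⟩
    | add x y hx hy =>
      obtain ⟨x', hx⟩ := hx
      obtain ⟨y', hy⟩ := hy
      exact ⟨x' + y', by rw [map_add, map_add, star_add, hx, hy]⟩
    | single g z =>
      refine ⟨MonoidAlgebra.single g⁻¹ (star z), ?_⟩
      rw [groupAlgebraMap_single, groupAlgebraMap_single, star_smul, map_inv]
      rfl

theorem groupAlgebraMap_mem (x : MonoidAlgebra ℂ Γ) :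
    groupAlgebraMap σ x ∈ generatedCStar σ := by
  induction x using MonoidAlgebra.induction_linear with
  | zero => rw [map_zero]; exact zero_mem _
  | add x y hx hy => rw [map_add]; exact add_mem hx hy
  | single g z =>
    rw [groupAlgebraMap_single]
    exact (generatedCStar σ).smul_mem (generator_mem σ g) z

/-- The canonical map `ℂΓ → C*_σ(Γ)`. -/
noncomputable def groupAlgebraMapGenerated : MonoidAlgebra ℂ Γ →ₐ[ℂ] generatedCStar σ :=
  (groupAlgebraMap σ).codRestrict (generatedCStar σ).toSubalgebra (groupAlgebraMap_mem σ)

theorem denseRange_groupAlgebraMapGenerated : DenseRange (groupAlgebraMapGenerated σ) := by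
  rintro ⟨a, ha⟩
  rw [closure_subtype]
  refine closure_mono ?_ (show a ∈ closure _ from ha)
  intro b hb
  obtain ⟨x, rfl⟩ := adjoin_range_le σ hb
  exact ⟨_, ⟨x, rfl⟩, rfl⟩

/-- If `σ` weakly contains the trivial representation, then the trivial representation extends to
a character of `C*_σ(Γ)`. -/
theorem WeaklyContains.hasCharacter (h : WeaklyContains σ (trivialRep Γ)) : HasCharacter σ := by
  let j := groupAlgebraMapGenerated σ
  let ε := groupAlgebraMap (trivialRep Γ)
  have hd : DenseRange j.toLinearMap := denseRange_groupAlgebraMapGenerated σ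
  let χ : generatedCStar σ →L[ℂ] ℂ := ε.toLinearMap.extendOfNorm j.toLinearMap
  -- `extendOfNorm` is known to extend the map only under a norm bound; weak containment is this
  -- bound with constant 1.
  have hχ : ∀ x, χ (j x) = ε x :=
    LinearMap.extendOfNorm_eq hd ⟨1, fun x => by rw [one_mul]; exact h x⟩
  refine ⟨χ, ?_, ?_⟩
  · intro h0
    have h1 : χ (j 1) = 0 := congrArg (fun f : WeakDual ℂ (generatedCStar σ) => f (j 1)) h0
    rw [hχ, map_one] at h1
    exact one_ne_zero h1
  · intro a b
    show χ (a * b) = χ a * χ b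
    induction a, b using (denseRange_groupAlgebraMapGenerated σ).induction_on₂ with
    | hp =>
      exact isClosed_eq (χ.continuous.comp continuous_mul)
        ((χ.continuous.comp continuous_fst).mul (χ.continuous.comp continuous_snd))
    | h x y =>
      show χ (j x * j y) = χ (j x) * χ (j y)
      rw [← map_mul, hχ, hχ, hχ, map_mul]

end WeakContainment

/-! ### States and their behaviour on unitaries -/

section States

variable {A : Type*} [CStarAlgebra A]

/-- A contractive unital functional is real on self-adjoint elements. -/
theorem im_eq_zero_of_isSelfAdjoint {φ : A →L[ℂ] ℂ} (hφ : ‖φ‖ ≤ 1) (h1 : φ 1 = 1) {a : A}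
    (ha : IsSelfAdjoint a) : (φ a).im = 0 := by
  have hle : ∀ x, ‖φ x‖ ≤ ‖x‖ := fun x => φ.le_of_opNorm_le_of_le hφ le_rfl |>.trans (by simp)
  -- The C*-identity gives ‖1‖ = ‖1‖², so no case distinction on the zero algebra is needed.
  have h1' : ‖(1 : A)‖ ≤ 1 := by
    have := CStarRing.norm_star_mul_self (x := (1 : A))
    rw [star_one, one_mul] at this
    nlinarith [norm_nonneg (1 : A)]
  -- Adding it·1 moves the imaginary part of φ(a) by t, while the squared norm is at most ‖a‖² + t².
  -- A nonzero imaginary part would violate this for suitable t.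
  have key : ∀ t : ℝ, ((φ a).im + t) ^ 2 ≤ ‖a‖ ^ 2 + t ^ 2 := by
    intro t
    have h2 : φ (a + (t * Complex.I : ℂ) • 1) = φ a + t * Complex.I := by
      rw [map_add, map_smul, h1, smul_eq_mul, mul_one]
    have h3 : ‖a + (t * Complex.I : ℂ) • (1 : A)‖ ^ 2 ≤ ‖a‖ ^ 2 + t ^ 2 := by
      have h4 : star (a + (t * Complex.I : ℂ) • (1 : A)) * (a + (t * Complex.I : ℂ) • 1) =
          a * a + ((t ^ 2 : ℝ) : ℂ) • 1 := by
        rw [star_add, star_smul, ha.star_eq, star_one]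
        simp only [Complex.star_def, map_mul, Complex.conj_ofReal, Complex.conj_I, mul_add, add_mul,
          smul_mul_assoc, mul_smul_comm, one_mul, mul_one, smul_add, smul_smul]
        rw [show (t * Complex.I * (t * -Complex.I) : ℂ) = ((t ^ 2 : ℝ) : ℂ) by
          push_cast; linear_combination (-(t : ℂ) ^ 2) * Complex.I_sq]
        rw [mul_neg, neg_smul]
        abel
      rw [sq, ← CStarRing.norm_star_mul_self, h4]
      refine (norm_add_le _ _).trans (add_le_add ((norm_mul_le _ _).trans (sq _).ge) ?_)
      rw [norm_smul, Complex.norm_real, Real.norm_of_nonneg (sq_nonneg t)]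
      exact mul_le_of_le_one_right (sq_nonneg t) h1'
    have h5 : |(φ a).im + t| ≤ ‖a + (t * Complex.I : ℂ) • (1 : A)‖ := by
      refine le_trans ?_ (hle _)
      rw [h2]
      refine le_trans (le_of_eq ?_) (Complex.abs_im_le_norm _)
      simp
    calc ((φ a).im + t) ^ 2 = |(φ a).im + t| ^ 2 := (sq_abs _).symm
      _ ≤ _ := pow_le_pow_left₀ (abs_nonneg _) h5 2
      _ ≤ _ := h3
  by_contra h
  -- With y = Im φ(a), this t solves 2yt = ‖a‖² + 1, whereas the bound reduces to y² + 2yt ≤ ‖a‖².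
  have h6 := key ((‖a‖ ^ 2 + 1) / (2 * (φ a).im))
  have h7 : (φ a).im * ((‖a‖ ^ 2 + 1) / (2 * (φ a).im)) = (‖a‖ ^ 2 + 1) / 2 := by
    field_simp
  nlinarith [sq_nonneg (φ a).im]

/-- For a ≥ 0 the element ‖a‖·1 − a has norm at most ‖a‖, so φ(a) lies in the disc of radius ‖a‖
about ‖a‖ and has nonnegative real part. -/
theorem nonneg_of_nonneg [PartialOrder A] [StarOrderedRing A] {φ : A →L[ℂ] ℂ} (hφ : ‖φ‖ ≤ 1)
    (h1 : φ 1 = 1) {a : A} (ha : 0 ≤ a) : 0 ≤ φ a := by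
  have him := im_eq_zero_of_isSelfAdjoint hφ h1 (IsSelfAdjoint.of_nonneg ha)
  have hnt : Nontrivial A := ⟨1, 0, fun h => by simp [h] at h1⟩
  have h2 : ‖algebraMap ℝ A ‖a‖ - a‖ ≤ ‖a‖ := by
    have h3 : a ≤ algebraMap ℝ A ‖a‖ := (IsSelfAdjoint.of_nonneg ha).le_algebraMap_norm_self
    refine (CStarAlgebra.norm_le_norm_of_nonneg_of_le (sub_nonneg.2 h3) (sub_le_self _ ha)).trans ?_
    rw [norm_algebraMap', norm_norm]
  have h4 : ‖φ (algebraMap ℝ A ‖a‖ - a)‖ ≤ ‖a‖ :=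
    (φ.le_of_opNorm_le_of_le hφ h2).trans (by simp)
  have h5 : φ (algebraMap ℝ A ‖a‖) = (‖a‖ : ℂ) := by
    rw [show algebraMap ℝ A ‖a‖ = (‖a‖ : ℂ) • (1 : A) by
      rw [Algebra.algebraMap_eq_smul_one, Complex.coe_smul], map_smul, h1, smul_eq_mul, mul_one]
  rw [map_sub, h5] at h4
  have h6 := (Complex.re_le_norm _).trans h4
  rw [Complex.sub_re, Complex.ofReal_re] at h6
  rw [Complex.le_def]
  refine ⟨?_, by simp [him]⟩
  simp only [Complex.zero_re]
  linarith

/-- A state is invariant under conjugation by a unitary on which it has modulus one. -/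
theorem apply_conj_unitary {φ : A →L[ℂ] ℂ} (hφ : ‖φ‖ ≤ 1) (h1 : φ 1 = 1) {u : A}
    (hu : u ∈ unitary A) (hφu : φ u * φ (star u) = 1) (a : A) : φ (u * a * star u) = φ a := by
  let _ := CStarAlgebra.spectralOrder A
  have _ := CStarAlgebra.spectralOrderedRing A
  let f : A →ₚ[ℂ] ℂ := PositiveLinearMap.mk₀ φ.toLinearMap fun x hx => nonneg_of_nonneg hφ h1 hx
  have hf : ∀ x, f x = φ x := fun _ => rfl
  let c := φ u
  have hstar : φ (star u) = star c := by rw [← hf, map_star f]; rfl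
  rw [hstar] at hφu
  -- Since c has modulus one, φ(b* b) = 1 − |c|² − |c|² + |c|² = 0, so b is a null vector of the GNS
  -- form of φ.
  let b : A := star u - star c • 1
  have hbb : φ (star b * b) = 0 := by
    have : star b * b = u * star u - star c • u - c • star u + (star c * c) • 1 := by
      simp only [b, star_sub, star_star, star_smul, star_one, sub_mul, mul_sub, smul_mul_assoc,
        mul_smul_comm, one_mul, mul_one, smul_sub, smul_smul]
      abel
    rw [this, (Unitary.mem_iff.1 hu).2, map_add, map_sub, map_sub, map_smul, map_smul, map_smul,
      h1, hstar, show φ u = c from rfl]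
    simp only [smul_eq_mul]
    linear_combination (-1 : ℂ) * hφu
  have hb : ‖f.toPreGNS b‖ = 0 := by
    have h := f.preGNS_norm_sq (f.toPreGNS b)
    rw [PositiveLinearMap.ofPreGNS_toPreGNS, hf, hbb] at h
    exact_mod_cast pow_eq_zero_iff (two_ne_zero) |>.1 h
  -- By Cauchy–Schwarz for (x, y) ↦ φ(x* y), the null vector b is orthogonal to everything on either
  -- side. Unfolding b then yields φ(u x) = c φ(x) and φ(x u*) = c̄ φ(x).
  have hinner : ∀ x : A, φ (star b * x) = 0 := by
    intro x
    have h := norm_inner_le_norm (𝕜 := ℂ) (f.toPreGNS b) (f.toPreGNS x)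
    rw [hb, zero_mul, f.preGNS_inner_def] at h
    exact norm_le_zero_iff.1 h
  have hinner' : ∀ x : A, φ (x * b) = 0 := by
    intro x
    have h := norm_inner_le_norm (𝕜 := ℂ) (f.toPreGNS (star x)) (f.toPreGNS b)
    rw [hb, mul_zero, f.preGNS_inner_def] at h
    simpa only [PositiveLinearMap.ofPreGNS_toPreGNS, star_star, hf] using norm_le_zero_iff.1 h
  have h2 : ∀ x : A, φ (u * x) = c * φ x := by
    intro x
    have h := hinner x
    simp only [b, star_sub, star_star, star_smul, star_one, sub_mul, smul_mul_assoc, one_mul,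
      map_sub, map_smul, smul_eq_mul] at h
    exact sub_eq_zero.1 h
  have h3 : ∀ x : A, φ (x * star u) = star c * φ x := by
    intro x
    have h := hinner' x
    simp only [b, mul_sub, mul_smul_comm, mul_one, map_sub, map_smul, smul_eq_mul] at h
    exact sub_eq_zero.1 h
  rw [h3, h2, ← mul_assoc, mul_comm (star c), hφu, one_mul]

variable {Γ : Type*} [Group Γ] {σ : Γ →* unitary A}

/-- Hahn–Banach extends the character without increasing its norm. The extension need not be
multiplicative; the relation on σ(g) and its adjoint retains the part of multiplicativity needed to
apply `apply_conj_unitary`. -/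
theorem HasCharacter.exists_state (h : HasCharacter σ) :
    ∃ φ : A →L[ℂ] ℂ, ‖φ‖ ≤ 1 ∧ φ 1 = 1 ∧ ∀ g, φ (σ g) * φ (star (σ g : A)) = 1 := by
  obtain ⟨χ₀, hχ₀⟩ := h
  -- Closedness makes C*_σ(Γ) a complete algebra, as the automatic contractivity of characters
  -- requires.
  have : IsClosed (generatedCStar σ : Set A) := StarSubalgebra.isClosed_topologicalClosure _
  let χ : generatedCStar σ →ₐ[ℂ] ℂ :=
    WeakDual.CharacterSpace.toAlgHom (⟨χ₀, hχ₀⟩ : WeakDual.characterSpace ℂ (generatedCStar σ))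
  have h1' : ‖(1 : generatedCStar σ)‖ ≤ 1 := by
    have := CStarRing.norm_star_mul_self (x := (1 : generatedCStar σ))
    rw [star_one, one_mul] at this
    nlinarith [norm_nonneg (1 : generatedCStar σ)]
  have hnorm : ∀ b, ‖χ b‖ ≤ ‖b‖ := fun b =>
    (AlgHom.norm_apply_le_self_mul_norm_one χ b).trans
      (mul_le_of_le_one_right (norm_nonneg b) h1')
  let f : StrongDual ℂ (generatedCStar σ).toSubalgebra.toSubmodule :=
    LinearMap.mkContinuous
      { toFun := fun b => χ ⟨b.1, b.2⟩
        map_add' := fun a b => map_add χ ⟨a.1, a.2⟩ ⟨b.1, b.2⟩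
        map_smul' := fun z b => map_smul χ z ⟨b.1, b.2⟩ } 1
      (fun b => (hnorm ⟨b.1, b.2⟩).trans (one_mul ‖b‖).ge)
  obtain ⟨φ, hφ, hφn⟩ := exists_extension_norm_eq _ f
  have hφχ : ∀ b : generatedCStar σ, φ b = χ b := fun b => hφ ⟨b.1, b.2⟩
  refine ⟨φ, ?_, ?_, ?_⟩
  · rw [hφn]
    exact LinearMap.mkContinuous_norm_le _ zero_le_one _
  · exact (hφχ 1).trans (map_one χ)
  · intro g
    have hg := generator_mem σ g
    rw [show φ (σ g) = χ ⟨σ g, hg⟩ from hφχ ⟨σ g, hg⟩,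
      show φ (star (σ g : A)) = χ ⟨star (σ g : A), star_mem hg⟩ from hφχ ⟨_, star_mem hg⟩,
      ← map_mul, ← map_one χ]
    congr 1
    exact Subtype.ext (Unitary.mem_iff.1 (σ g).2).2

end States

/-! ### The invariant measure obtained from a character -/

section InvariantMeasure

variable {G : Type u} [TopologicalSpace G] [TopologicalGroupoid G] [IsAmple G]
  [CompactSpace (UnitSpace G)]

theorem Cc.ofUnits_apply (h : C(UnitSpace G, ℂ)) (c : G) :
    Cc.ofUnits h c = (unitSet G).indicator (fun g => h (srcMap g)) c := rfl

/-- `h * 1_U = 1_U * (h ∘ θ_U)`. -/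
theorem ofUnits_mul_charFn (U : TopFullGroup G) (h k : C(UnitSpace G, ℂ))
    (hk : ∀ x, k x = h (U.theta x)) :
    Cc.ofUnits h * U.charFn = U.charFn * Cc.ofUnits k := by
  refine Cc.ext fun c => ?_
  obtain ⟨a, ha, hac⟩ := U.exists_rng c
  have h1 : (Cc.ofUnits h * U.charFn) c =
      Cc.ofUnits h (rng c) * U.charFn ((rng c)⁻¹ * c) :=
    conv_eq_of_mem (S := unitSet G) unitSet_bisection.1 Set.support_indicator_subset _
      (src_rng c) (rng_rng c)
  have h2 : (U.charFn * Cc.ofUnits k) c = U.charFn a * Cc.ofUnits k (a⁻¹ * c) :=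
    conv_eq_of_mem U.isBisection.1 Set.support_indicator_subset _ ha hac
  have hu : ∀ d, U.charFn d = U.carrier.indicator (fun _ => (1 : ℂ)) d := fun _ => rfl
  rw [h1, h2, inv_of_src (src_rng c), rng_gmul, Cc.ofUnits_apply, Cc.ofUnits_apply, hu, hu,
    Set.indicator_of_mem ha, Set.indicator_of_mem (show rng c ∈ unitSet G from src_rng c), one_mul]
  -- Both sides are supported in U. If c ∈ U, the arrow a of U with the range of c is c itself;
  -- otherwise a⁻¹c is not a unit, since that would force c = a.
  by_cases hc : c ∈ U.carrier
  · obtain rfl := U.isBisection.1 ha hc hac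
    rw [Set.indicator_of_mem ha, inv_gmul,
      Set.indicator_of_mem (show src a ∈ unitSet G from src_src a), mul_one, hk]
    congr 1
    rw [show srcMap (src a) = srcMap a from Subtype.ext (src_src a), U.theta_srcMap ha]
    exact Subtype.ext (src_rng a)
  · rw [Set.indicator_of_notMem hc, mul_zero, Set.indicator_of_notMem]
    intro hm
    apply hc
    have hr : rng (a⁻¹ * c) = src a := by rw [rng_mul _ _ (by rw [src_inv, hac]), rng_inv]
    have : a⁻¹ * c = src a := by rw [← hr]; exact (rng_of_src hm).symm
    rw [← mul_inv_cancel_left' hac, this, gmul_src]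
    exact ha

/-- The canonical map `C(G⁽⁰⁾) → C*(G)`. -/
noncomputable def FullCStar.ofUnits : C(UnitSpace G, ℂ) →ₗ[ℂ] FullCStar G where
  toFun h := FullCStar.of (Cc.ofUnits h)
  map_add' h k := by rw [map_add, FullCStar.of_add]
  map_smul' z h := by rw [map_smul, FullCStar.of_smul]; rfl

theorem FullCStar.ofUnits_star_mul (h k : C(UnitSpace G, ℂ)) :
    FullCStar.ofUnits (star h * k) = star (FullCStar.ofUnits h) * FullCStar.ofUnits k := by
  show FullCStar.of _ = star (FullCStar.of _) * FullCStar.of _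
  rw [map_mul, map_star, FullCStar.of_mul, FullCStar.of_star]

variable [MeasurableSpace (UnitSpace G)] [BorelSpace (UnitSpace G)]

/-- A state on `C*(G)` restricts to a probability measure on the unit space. -/
theorem exists_measure_of_state {φ : FullCStar G →L[ℂ] ℂ} (hφ : ‖φ‖ ≤ 1) (h1 : φ 1 = 1) :
    ∃ μ : Measure (UnitSpace G), IsProbabilityMeasure μ ∧ μ.Regular ∧
      ∀ (f : C(UnitSpace G, ℝ)) (h : C(UnitSpace G, ℂ)), (∀ x, h x = f x) →
        ∫ x, f x ∂μ = (φ (FullCStar.ofUnits h)).re := by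
  let _ := CStarAlgebra.spectralOrder (FullCStar G)
  have _ := CStarAlgebra.spectralOrderedRing (FullCStar G)
  let ι : C(UnitSpace G, ℝ) → C(UnitSpace G, ℂ) := fun f =>
    ⟨fun x => (f x : ℂ), Complex.continuous_ofReal.comp f.continuous⟩
  let Λ₀ : CompactlySupportedContinuousMap (UnitSpace G) ℝ →ₗ[ℝ] ℝ :=
    { toFun := fun f => (φ (FullCStar.ofUnits (ι f.toContinuousMap))).re
      map_add' := fun f g => by
        rw [← Complex.add_re, ← map_add, ← map_add]
        congr 3
        ext x
        simp [ι]
      map_smul' := fun r f => by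
        rw [show ι (r • f).toContinuousMap = (r : ℂ) • ι f.toContinuousMap by ext x; simp [ι],
          map_smul, map_smul]
        simp }
  have hpos : ∀ f, 0 ≤ f → 0 ≤ Λ₀ f := by
    intro f hf
    -- A nonnegative f is k* k with k = √f, so its image in C*(G) is positive.
    let k : C(UnitSpace G, ℂ) := ι ⟨fun x => √(f x), f.continuous.sqrt⟩
    have hk : ι f.toContinuousMap = star k * k := by
      ext x
      show ((f x : ℝ) : ℂ) = star ((√(f x) : ℝ) : ℂ) * ((√(f x) : ℝ) : ℂ)
      rw [Complex.star_def, Complex.conj_ofReal, ← Complex.ofReal_mul, Real.mul_self_sqrt (hf x)]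
    show 0 ≤ (φ (FullCStar.ofUnits (ι f.toContinuousMap))).re
    rw [hk, FullCStar.ofUnits_star_mul]
    exact (Complex.le_def.1 (nonneg_of_nonneg hφ h1 (star_mul_self_nonneg _))).1
  let Λ : CompactlySupportedContinuousMap (UnitSpace G) ℝ →ₚ[ℝ] ℝ := PositiveLinearMap.mk₀ Λ₀ hpos
  have hint : ∀ (f : C(UnitSpace G, ℝ)) (h : C(UnitSpace G, ℂ)), (∀ x, h x = f x) →
        ∫ x, f x ∂(RealRMK.rieszMeasure Λ) = (φ (FullCStar.ofUnits h)).re := by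
    intro f h hfh
    obtain rfl : h = ι f := ContinuousMap.ext hfh
    exact RealRMK.integral_rieszMeasure Λ ⟨f, HasCompactSupport.of_compactSpace f⟩
  refine ⟨RealRMK.rieszMeasure Λ, ?_, inferInstance, hint⟩
  have h2 := hint 1 1 (fun x => by simp)
  rw [show FullCStar.ofUnits (1 : C(UnitSpace G, ℂ)) = 1 from rfl, h1] at h2
  simp only [ContinuousMap.one_apply, integral_const, smul_eq_mul, mul_one, Complex.one_re] at h2
  exact ⟨(ENNReal.toReal_eq_one_iff _).1 h2⟩

/-- If `C*_π(Γ)` admits a character, then there is a `Γ`-invariant probability measure. -/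
theorem exists_subgroupInvariant_measure {Γ : Subgroup (TopFullGroup G)}
    (h : HasCharacter ((TopFullGroup.canonicalRep G).comp Γ.subtype)) :
    ∃ μ : Measure (UnitSpace G), IsProbabilityMeasure μ ∧ μ.Regular ∧ IsSubgroupInvariant Γ μ := by
  obtain ⟨φ, hφ, h1, hΓ⟩ := h.exists_state
  obtain ⟨μ, hμ, hreg, hint⟩ := exists_measure_of_state hφ h1
  refine ⟨μ, hμ, hreg, fun U hU => ⟨U.continuous_theta.measurable, ?_⟩⟩
  -- Regularity of both measures allows them to be compared through integrals of continuous
  -- functions.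
  have : (μ.map U.theta).Regular := Measure.Regular.map U.thetaHomeomorph
  have : IsProbabilityMeasure (μ.map U.theta) :=
    Measure.isProbabilityMeasure_map U.continuous_theta.measurable.aemeasurable
  refine Measure.ext_of_integral_eq_on_compactlySupported fun f => ?_
  rw [integral_map U.continuous_theta.measurable.aemeasurable
    (map_continuous f).aestronglyMeasurable]
  let ι : C(UnitSpace G, ℝ) → C(UnitSpace G, ℂ) := fun f =>
    ⟨fun x => (f x : ℂ), Complex.continuous_ofReal.comp f.continuous⟩
  let f' : C(UnitSpace G, ℝ) := f.toContinuousMap.comp ⟨U.theta, U.continuous_theta⟩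
  refine (hint f' (ι f') fun _ => rfl).trans
    (Eq.trans ?_ (hint f.toContinuousMap (ι f.toContinuousMap) fun _ => rfl).symm)
  congr 1
  let π := (TopFullGroup.canonicalRep G).comp Γ.subtype
  let u : FullCStar G := FullCStar.of U.charFn
  have hu : u ∈ unitary (FullCStar G) := (π ⟨U, hU⟩).2
  have hcomm : FullCStar.ofUnits (ι f.toContinuousMap) * u = u * FullCStar.ofUnits (ι f') := by
    show FullCStar.of _ * FullCStar.of _ = FullCStar.of _ * FullCStar.of _
    rw [← FullCStar.of_mul, ← FullCStar.of_mul,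
      ofUnits_mul_charFn U (ι f.toContinuousMap) (ι f') fun _ => rfl]
  -- The chain is φ(f ∘ θ_U) = φ(u (f ∘ θ_U) u*) = φ(f u u*) = φ(f).
  rw [← apply_conj_unitary hφ h1 hu (hΓ ⟨U, hU⟩) (FullCStar.ofUnits (ι f')), ← hcomm, mul_assoc,
    (Unitary.mem_iff.1 hu).2, mul_one]

end InvariantMeasure

/-! ### The action of C_c(G) on continuous functions on the unit space -/

section Action

variable {G : Type u} [TopologicalSpace G] [TopologicalGroupoid G] [IsAmple G]
  [CompactSpace (UnitSpace G)]

namespace Cc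

/-- Compact support of g is not required because the result is applied to ξ ∘ r, whose support need
not be compact. -/
theorem continuous_conv (f : Cc G) {g : G → ℂ} (hg : Continuous g) : Continuous (conv f.1 g) := by
  induction f using induction_bisection with
  | hadd f₁ f₂ h₁ h₂ =>
    rw [conv_add_left]
    exact h₁.add h₂
  | hbis S ho hc hS f hf =>
    rw [continuous_iff_continuousAt]
    intro c
    by_cases hex : ∃ a ∈ S, rng a = rng c
    · obtain ⟨a, ha, hac⟩ := hex
      obtain ⟨τ, h1, h2, h3⟩ := exists_section ho ha hac
      have h4 := continuousAt_inv_mul h2 (h3.mono fun _ h => h.2)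
      have h5 : ContinuousAt (fun d => f (τ d) * g ((τ d)⁻¹ * d)) c :=
        (ContinuousAt.comp (g := f.1) f.2.1.continuousAt h2).mul
          (ContinuousAt.comp (g := g) (f := fun d => (τ d)⁻¹ * d) hg.continuousAt h4)
      refine h5.congr ?_
      filter_upwards [h3] with d hd
      exact (conv_eq_of_mem hS.1 hf _ hd.1 hd.2).symm
    · have hcl : IsClosed (rng ⁻¹' (rng '' S)) :=
        (hc.image continuous_rng).isClosed.preimage continuous_rng
      have h1 : ∀ᶠ d in nhds c, d ∉ rng ⁻¹' (rng '' S) :=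
        hcl.isOpen_compl.mem_nhds hex
      refine (continuousAt_const (y := (0 : ℂ))).congr ?_
      filter_upwards [h1] with d hd
      exact (conv_eq_zero hf _ (fun a ha h => hd ⟨a, ha, h⟩)).symm

theorem conv_conv (f g : Cc G) (h : G → ℂ) : conv (conv f.1 g.1) h = conv f.1 (conv g.1 h) := by
  induction f using induction_bisection with
  | hadd f₁ f₂ h₁ h₂ =>
    rw [conv_add_left, conv_add_left, ← h₁, ← h₂]
    exact conv_add_left (f₁ * g) (f₂ * g) h
  | hbis S ho hc hS f hf => exact conv_assoc_of_support hS.1 hf g.1 h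

/-- A function ξ on G⁽⁰⁾ is viewed as ξ ∘ r on G. The formula depends on c only through r(c), so
left convolution preserves such functions, and associativity of convolution becomes the module law
`act_mul`. -/
theorem conv_comp_rngMap (f : G → ℂ) (ξ : UnitSpace G → ℂ) (c : G) :
    conv f (ξ ∘ rngMap) c = ∑ᶠ a : {a : G // rng a = rng c}, f a.1 * ξ (srcMap a.1) := by
  rw [conv_eq]
  refine finsum_congr fun a => ?_
  rw [Function.comp_apply]
  congr 2
  exact Subtype.ext ((rng_mul _ _ (by rw [src_inv, a.2])).trans (rng_inv _))

/-- The action of `C_c(G)` on `C(G⁽⁰⁾)`, `(f ξ)(x) = ∑_{r(a) = x} f(a) ξ(s(a))`. -/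
noncomputable def act (f : Cc G) : C(UnitSpace G, ℂ) →ₗ[ℂ] C(UnitSpace G, ℂ) where
  toFun ξ := ⟨fun x => conv f.1 (ξ ∘ rngMap) x.1,
    (f.continuous_conv (ξ.continuous.comp continuous_rngMap)).comp continuous_subtype_val⟩
  map_add' ξ η := ContinuousMap.ext fun x =>
    congrFun (conv_add_right f (ξ ∘ rngMap) (η ∘ rngMap)) x.1
  map_smul' z ξ := ContinuousMap.ext fun x => congrFun (conv_smul_right z f.1 (ξ ∘ rngMap)) x.1

theorem act_apply (f : Cc G) (ξ : C(UnitSpace G, ℂ)) (x : UnitSpace G) :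
    f.act ξ x = conv f.1 (ξ ∘ rngMap) x.1 := rfl

theorem act_comp_rngMap (f : Cc G) (ξ : C(UnitSpace G, ℂ)) :
    f.act ξ ∘ rngMap = conv f.1 (ξ ∘ rngMap) := by
  funext c
  show conv f.1 (ξ ∘ rngMap) (rng c) = _
  rw [conv_comp_rngMap, conv_comp_rngMap, rng_rng]

theorem act_add (f g : Cc G) (ξ : C(UnitSpace G, ℂ)) : (f + g).act ξ = f.act ξ + g.act ξ :=
  ContinuousMap.ext fun x => congrFun (conv_add_left f g (ξ ∘ rngMap)) x.1

theorem act_smul (z : ℂ) (f : Cc G) (ξ : C(UnitSpace G, ℂ)) : (z • f).act ξ = z • f.act ξ :=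
  ContinuousMap.ext fun x => congrFun (conv_smul_left z f.1 (ξ ∘ rngMap)) x.1

theorem act_mul (f g : Cc G) (ξ : C(UnitSpace G, ℂ)) : (f * g).act ξ = f.act (g.act ξ) :=
  ContinuousMap.ext fun x => by
    rw [act_apply, act_apply, act_comp_rngMap, ← conv_conv]
    rfl

theorem act_apply_of_mem {S : Set G} (hS : Set.InjOn rng S) {f : Cc G}
    (hf : Function.support f.1 ⊆ S) (ξ : C(UnitSpace G, ℂ)) {a : G} (ha : a ∈ S) :
    f.act ξ (rngMap a) = f a * ξ (srcMap a) := by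
  refine (conv_eq_of_mem hS hf _ ha (rng_rng a).symm).trans ?_
  rw [Function.comp_apply]
  congr 2
  exact Subtype.ext ((rng_mul _ _ (by rw [src_inv]; exact (rng_rng a).symm)).trans (rng_inv a))

theorem act_apply_eq_zero {S : Set G} {f : Cc G} (hf : Function.support f.1 ⊆ S)
    (ξ : C(UnitSpace G, ℂ)) {x : UnitSpace G} (hx : x ∉ rngMap '' S) : f.act ξ x = 0 :=
  conv_eq_zero hf _ fun a ha h => hx ⟨a, ha, Subtype.ext (h.trans (rng_of_src x.2))⟩

theorem act_ofUnits (η ξ : C(UnitSpace G, ℂ)) : (ofUnits η).act ξ = η * ξ := by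
  ext x
  have hx : x.1 ∈ unitSet G := x.2
  have h := act_apply_of_mem (f := ofUnits η) unitSet_bisection.1 Set.support_indicator_subset ξ hx
  rw [show rngMap x.1 = x from Subtype.ext (rng_of_src x.2),
    show srcMap x.1 = x from Subtype.ext x.2, ofUnits_apply, Set.indicator_of_mem hx,
    show srcMap x.1 = x from Subtype.ext x.2] at h
  exact h

/-- Every unit is the range of exactly one arrow of U, so the defining sum has the single term 1.
This fixed vector is what detects the trivial representation. -/
theorem act_charFn (U : TopFullGroup G) : U.charFn.act 1 = 1 := by
  ext x
  obtain ⟨y, rfl⟩ := U.theta_surjective x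
  obtain ⟨a, ha, rfl⟩ := U.exists_src_eq y
  rw [U.theta_srcMap ha, act_apply_of_mem U.isBisection.1 Set.support_indicator_subset 1 ha]
  show U.carrier.indicator (fun _ => (1 : ℂ)) a * 1 = 1
  rw [Set.indicator_of_mem ha, one_mul]

/-- If `f` is supported in a bisection, then `f* f` is supported in the unit space. -/
theorem exists_star_mul_self_eq_ofUnits {S : Set G} (hS : IsBisection S) {f : Cc G}
    (hf : Function.support f.1 ⊆ S) : ∃ h : C(UnitSpace G, ℂ), star f * f = ofUnits h := by
  let h : C(UnitSpace G, ℂ) :=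
    ⟨fun x => (star f * f) x.1, (star f * f).2.1.comp continuous_subtype_val⟩
  refine ⟨h, Cc.ext fun c => ?_⟩
  rw [ofUnits_apply]
  by_cases hcu : c ∈ unitSet G
  · rw [Set.indicator_of_mem hcu]
    show (star f * f) c = (star f * f) (src c)
    rw [show src c = c from hcu]
  · rw [Set.indicator_of_notMem hcu]
    refine finsum_eq_zero_of_forall_eq_zero ?_
    rintro ⟨⟨a, b⟩, h1, h2⟩
    simp only at h1 h2 ⊢
    by_contra hne
    apply hcu
    have ha : f a⁻¹ ≠ 0 := fun h0 => left_ne_zero_of_mul hne (by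
      show (starRingEnd ℂ) (f a⁻¹) = 0
      rw [h0, map_zero])
    have hab : a⁻¹ = b := hS.1 (hf ha) (hf (right_ne_zero_of_mul hne)) (by rw [rng_inv, h1])
    show src c = c
    rw [← h2, ← hab, gmul_inv, src_rng]

end Cc

end Action

/-! ### Invariance as a symmetry between r and s -/

section IntegralOverBisection

/-- Moves integrals over r(S) and over s(S) to the common domain S, where they can be compared. -/
theorem integral_eq_integral_comap {X Y : Type*} [TopologicalSpace X] [MeasurableSpace X]
    [BorelSpace X] [TopologicalSpace Y] [MeasurableSpace Y] [BorelSpace Y] {e : Y → X}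
    (he : Topology.IsOpenEmbedding e) (μ : Measure X) {g : X → ℂ}
    (hg : ∀ x ∉ Set.range e, g x = 0) : ∫ x, g x ∂μ = ∫ y, g (e y) ∂(μ.comap e) := by
  rw [← he.measurableEmbedding.integral_map, he.measurableEmbedding.map_comap,
    setIntegral_eq_integral_of_forall_compl_eq_zero hg]

variable {G : Type u} [TopologicalSpace G] [TopologicalGroupoid G] [IsAmple G]
  [CompactSpace (UnitSpace G)] [MeasurableSpace (UnitSpace G)] [BorelSpace (UnitSpace G)]

/-- An invariant measure induces the same measure on a bisection through `r` and through `s`. -/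
theorem IsGroupoidInvariant.comap_eq {μ : Measure (UnitSpace G)} [IsFiniteMeasure μ]
    (hμ : IsGroupoidInvariant μ) {S : Set G} (hS : IsOpen S) (hbis : IsBisection S)
    [MeasurableSpace S] [BorelSpace S] :
    μ.comap (S.domRestrict rngMap) = μ.comap (S.domRestrict srcMap) := by
  have her := (isOpenEmbedding_domRestrict IsAmple.isLocalHomeomorph_rng hS
    fun a ha b hb h => hbis.1 ha hb (congrArg Subtype.val h)).measurableEmbedding
  have hes := (isOpenEmbedding_domRestrict IsAmple.isLocalHomeomorph_src hS
    fun a ha b hb h => hbis.2 ha hb (congrArg Subtype.val h)).measurableEmbedding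
  -- Open subsets of S are again open bisections, and they form a π-system generating the Borel sets
  -- of S.
  have key : ∀ V : Set S, IsOpen V → μ.comap (S.domRestrict rngMap) V =
      μ.comap (S.domRestrict srcMap) V := by
    intro V hV
    have hsub : Subtype.val '' V ⊆ S := by
      rintro _ ⟨a, -, rfl⟩
      exact a.2
    have h := hμ (Subtype.val '' V) (hS.isOpenMap_subtype_val V hV)
      ⟨hbis.1.mono hsub, hbis.2.mono hsub⟩
    rw [Set.image_image, Set.image_image] at h
    rw [her.comap_apply, hes.comap_apply]
    exact h
  have hfin : IsFiniteMeasure (μ.comap (S.domRestrict (rngMap : G → UnitSpace G))) :=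
    ⟨by rw [her.comap_apply]; exact measure_lt_top μ _⟩
  exact ext_of_generate_finite {V : Set S | IsOpen V} (BorelSpace.measurable_eq)
    isPiSystem_isOpen key (key _ isOpen_univ)

theorem Cc.support_star {f : Cc G} {S : Set G} (hf : Function.support f.1 ⊆ S) :
    Function.support (star f).1 ⊆ {a | a⁻¹ ∈ S} := by
  intro a ha
  apply hf
  intro h0
  apply ha
  show (starRingEnd ℂ) (f a⁻¹) = 0
  rw [h0, map_zero]

theorem integrable_continuousMap (μ : Measure (UnitSpace G)) [IsFiniteMeasure μ]
    (ξ : C(UnitSpace G, ℂ)) : Integrable ξ μ :=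
  ξ.continuous.integrable_of_hasCompactSupport (HasCompactSupport.of_compactSpace ξ)

/-- The functional `f ↦ ∫ ∑_{r(a) = x} f(a) dμ(x)` on `C_c(G)` is hermitian if `μ` is
invariant. -/
theorem IsGroupoidInvariant.integral_act_star {μ : Measure (UnitSpace G)} [IsFiniteMeasure μ]
    (hμ : IsGroupoidInvariant μ) (f : Cc G) :
    ∫ x, (star f).act 1 x ∂μ = (starRingEnd ℂ) (∫ x, f.act 1 x ∂μ) := by
  induction f using Cc.induction_bisection with
  | hadd f g hf hg =>
    simp only [star_add, Cc.act_add, ContinuousMap.add_apply]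
    rw [integral_add (integrable_continuousMap μ _) (integrable_continuousMap μ _),
      integral_add (integrable_continuousMap μ _) (integrable_continuousMap μ _), map_add, hf, hg]
  | hbis S ho hc hS f hf =>
    let _ : MeasurableSpace S := borel S
    have : BorelSpace S := ⟨rfl⟩
    have her := isOpenEmbedding_domRestrict IsAmple.isLocalHomeomorph_rng ho
      fun a ha b hb h => hS.1 ha hb (congrArg Subtype.val h)
    have hes := isOpenEmbedding_domRestrict IsAmple.isLocalHomeomorph_src ho
      fun a ha b hb h => hS.2 ha hb (congrArg Subtype.val h)
    have hS' : Set.InjOn rng {a : G | a⁻¹ ∈ S} := by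
      intro a ha b hb h
      rw [← inv_inv' a, hS.2 ha hb (by rw [src_inv, src_inv, h]), inv_inv']
    -- Pulled back to S, along s for f* and along r for f, both integrands are the conjugate of
    -- f(a). The remaining goals say that they vanish off s(S) and r(S).
    rw [← integral_conj, integral_eq_integral_comap her μ (g := fun x => (starRingEnd ℂ) (f.act 1 x)),
      integral_eq_integral_comap hes μ (g := fun x => (star f).act 1 x), hμ.comap_eq ho hS]
    · congr 1
      funext a
      rw [Set.domRestrict_apply, Set.domRestrict_apply, Cc.act_apply_of_mem hS.1 hf 1 a.2,
        show (srcMap a.1 : UnitSpace G) = rngMap a.1⁻¹ from Subtype.ext (rng_inv a.1).symm,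
        Cc.act_apply_of_mem hS' (Cc.support_star hf) 1
          (show a.1⁻¹⁻¹ ∈ S by rw [inv_inv']; exact a.2)]
      show (starRingEnd ℂ) (f a.1⁻¹⁻¹) * 1 = (starRingEnd ℂ) (f a.1 * 1)
      rw [inv_inv', mul_one, mul_one]
    · intro x hx
      refine Cc.act_apply_eq_zero (Cc.support_star hf) 1 ?_
      rintro ⟨a, ha, rfl⟩
      exact hx ⟨⟨a⁻¹, ha⟩, Subtype.ext (src_inv a)⟩
    · intro x hx
      rw [Cc.act_apply_eq_zero hf, map_zero]
      rwa [Set.range_domRestrict] at hx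

theorem IsGroupoidInvariant.integral_star_mul_act {μ : Measure (UnitSpace G)} [IsFiniteMeasure μ]
    (hμ : IsGroupoidInvariant μ) (f : Cc G) (ξ η : C(UnitSpace G, ℂ)) :
    ∫ x, f.act η x * (starRingEnd ℂ) (ξ x) ∂μ =
      ∫ x, η x * (starRingEnd ℂ) ((star f).act ξ x) ∂μ := by
  -- The functions ξ and η are absorbed into C_c(G): the pairing is the functional f ↦ ∫ f·1
  -- evaluated at ξ* f η, whose adjoint is η* f* ξ.
  have key : ∀ (f : Cc G) (ξ η : C(UnitSpace G, ℂ)),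
      ∫ x, f.act η x * (starRingEnd ℂ) (ξ x) ∂μ =
      ∫ x, (Cc.ofUnits (star ξ) * f * Cc.ofUnits η).act 1 x ∂μ := by
    intro f ξ η
    congr 1
    funext x
    rw [Cc.act_mul, Cc.act_mul, Cc.act_ofUnits, Cc.act_ofUnits, mul_one, mul_comm]
    rfl
  have h := hμ.integral_act_star (Cc.ofUnits (star ξ) * f * Cc.ofUnits η)
  rw [← key, star_mul, star_mul, ← map_star, ← map_star, star_star, ← mul_assoc, ← key] at h
  have h2 := congrArg (starRingEnd ℂ) h
  rw [Complex.conj_conj, ← integral_conj] at h2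
  rw [← h2]
  congr 1
  funext x
  rw [map_mul, Complex.conj_conj, mul_comm]

end IntegralOverBisection

/-! ### The Koopman representation on L²(μ) -/

section Koopman

variable {G : Type u} [TopologicalSpace G] [TopologicalGroupoid G] [IsAmple G]
  [CompactSpace (UnitSpace G)] [MeasurableSpace (UnitSpace G)] [BorelSpace (UnitSpace G)]
  (μ : Measure (UnitSpace G)) [IsFiniteMeasure μ]

/-- The canonical map `C(G⁽⁰⁾) → L²(μ)`. -/
noncomputable abbrev unitToLp : C(UnitSpace G, ℂ) →L[ℂ] Lp ℂ 2 μ := ContinuousMap.toLp 2 μ ℂ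

theorem denseRange_unitToLp [μ.Regular] : DenseRange (unitToLp μ) :=
  ContinuousMap.toLp_denseRange ℂ μ ℂ (by norm_num)

theorem norm_unitToLp_mul_le (h ξ : C(UnitSpace G, ℂ)) :
    ‖unitToLp μ (h * ξ)‖ ≤ ‖h‖ * ‖unitToLp μ ξ‖ := by
  refine Lp.norm_le_mul_norm_of_ae_le_mul ?_
  filter_upwards [ContinuousMap.coeFn_toLp (p := 2) (𝕜 := ℂ) μ (h * ξ),
    ContinuousMap.coeFn_toLp (p := 2) (𝕜 := ℂ) μ ξ] with x h1 h2
  rw [h1, h2, ContinuousMap.mul_apply, norm_mul]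
  exact mul_le_mul_of_nonneg_right (h.norm_coe_le_norm x) (norm_nonneg _)

variable {μ}

theorem IsGroupoidInvariant.inner_act (hμ : IsGroupoidInvariant μ) (f : Cc G)
    (ξ η : C(UnitSpace G, ℂ)) :
    ⟪unitToLp μ ξ, unitToLp μ (f.act η)⟫_ℂ = ⟪unitToLp μ ((star f).act ξ), unitToLp μ η⟫_ℂ := by
  rw [ContinuousMap.inner_toLp, ContinuousMap.inner_toLp]
  exact hμ.integral_star_mul_act f ξ η

/-- For f supported in a bisection, f* f is multiplication by some continuous h, so ‖fξ‖² = ⟨hξ, ξ⟩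
≤ ‖h‖‖ξ‖². A general f is a finite sum of such functions. -/
theorem IsGroupoidInvariant.exists_norm_act_le (hμ : IsGroupoidInvariant μ) (f : Cc G) :
    ∃ C : ℝ, ∀ ξ, ‖unitToLp μ (f.act ξ)‖ ≤ C * ‖unitToLp μ ξ‖ := by
  induction f using Cc.induction_bisection with
  | hadd f g hf hg =>
    obtain ⟨C, hC⟩ := hf
    obtain ⟨D, hD⟩ := hg
    refine ⟨C + D, fun ξ => ?_⟩
    rw [Cc.act_add, map_add, add_mul]
    exact (norm_add_le _ _).trans (add_le_add (hC ξ) (hD ξ))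
  | hbis S ho hc hS f hf =>
    obtain ⟨h, hh⟩ := Cc.exists_star_mul_self_eq_ofUnits hS hf
    refine ⟨√‖h‖, fun ξ => ?_⟩
    rw [← Real.sqrt_sq (norm_nonneg (unitToLp μ ξ)), ← Real.sqrt_mul (norm_nonneg h)]
    apply Real.le_sqrt_of_sq_le
    have h1 : ⟪unitToLp μ (f.act ξ), unitToLp μ (f.act ξ)⟫_ℂ =
        ⟪unitToLp μ (h * ξ), unitToLp μ ξ⟫_ℂ := by
      rw [hμ.inner_act, ← Cc.act_mul, hh, Cc.act_ofUnits]
    calc ‖unitToLp μ (f.act ξ)‖ ^ 2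
        = ‖⟪unitToLp μ (f.act ξ), unitToLp μ (f.act ξ)⟫_ℂ‖ := by
          rw [inner_self_eq_norm_sq_to_K]
          simp
      _ ≤ ‖unitToLp μ (h * ξ)‖ * ‖unitToLp μ ξ‖ := by
          rw [h1]
          exact norm_inner_le_norm _ _
      _ ≤ ‖h‖ * ‖unitToLp μ ξ‖ * ‖unitToLp μ ξ‖ :=
          mul_le_mul_of_nonneg_right (norm_unitToLp_mul_le μ h ξ) (norm_nonneg _)
      _ = ‖h‖ * ‖unitToLp μ ξ‖ ^ 2 := by ring

variable (μ) in
/-- The operator on `L²(μ)` extending the action of `f ∈ C_c(G)` on `C(G⁽⁰⁾)`. -/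
noncomputable def actLp (f : Cc G) : Lp ℂ 2 μ →L[ℂ] Lp ℂ 2 μ :=
  -- The definition carries no boundedness hypothesis; `exists_norm_act_le` supplies the bound in
  -- `actLp_apply`.
  ((unitToLp μ).toLinearMap ∘ₗ f.act).extendOfNorm (unitToLp μ).toLinearMap

variable [μ.Regular]

theorem IsGroupoidInvariant.actLp_apply (hμ : IsGroupoidInvariant μ) (f : Cc G)
    (ξ : C(UnitSpace G, ℂ)) : actLp μ f (unitToLp μ ξ) = unitToLp μ (f.act ξ) :=
  LinearMap.extendOfNorm_eq (denseRange_unitToLp μ) (hμ.exists_norm_act_le f) ξ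

theorem ext_unitToLp {S T : Lp ℂ 2 μ →L[ℂ] Lp ℂ 2 μ}
    (h : ∀ ξ, S (unitToLp μ ξ) = T (unitToLp μ ξ)) : S = T :=
  ContinuousLinearMap.coeFn_injective
    ((denseRange_unitToLp μ).equalizer S.continuous T.continuous (funext h))

/-- The Koopman representation of `C_c(G)` on `L²(μ)` for an invariant measure `μ`. -/
noncomputable def IsGroupoidInvariant.koopman (hμ : IsGroupoidInvariant μ) : StarRep G where
  H := Lp ℂ 2 μ
  toHom :=
    { toFun := actLp μ
      map_smul' := fun z f => ext_unitToLp fun ξ => by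
        show actLp μ (z • f) (unitToLp μ ξ) = z • actLp μ f (unitToLp μ ξ)
        rw [hμ.actLp_apply, hμ.actLp_apply, Cc.act_smul, map_smul]
      map_zero' := ext_unitToLp fun ξ => by
        rw [hμ.actLp_apply, ← zero_smul ℂ (0 : Cc G), Cc.act_smul, zero_smul, map_zero]
        rfl
      map_add' := fun f g => ext_unitToLp fun ξ => by
        show actLp μ (f + g) (unitToLp μ ξ) = actLp μ f (unitToLp μ ξ) + actLp μ g (unitToLp μ ξ)
        rw [hμ.actLp_apply, hμ.actLp_apply, hμ.actLp_apply, Cc.act_add, map_add]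
      map_mul' := fun f g => ext_unitToLp fun ξ => by
        show actLp μ (f * g) (unitToLp μ ξ) = actLp μ f (actLp μ g (unitToLp μ ξ))
        rw [hμ.actLp_apply, hμ.actLp_apply, hμ.actLp_apply, Cc.act_mul]
      map_star' := fun f => by
        rw [ContinuousLinearMap.star_eq_adjoint, ContinuousLinearMap.eq_adjoint_iff]
        intro v w
        induction v, w using (denseRange_unitToLp μ).induction_on₂ with
        | hp =>
          exact isClosed_eq
            (((actLp μ (star f)).continuous.comp continuous_fst).inner continuous_snd)
            (continuous_fst.inner ((actLp μ f).continuous.comp continuous_snd))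
        | h ξ η => rw [hμ.actLp_apply, hμ.actLp_apply, hμ.inner_act] }

/-- If there is a `G`-invariant probability measure, then `π|_Γ` weakly contains the trivial
representation. -/
theorem IsGroupoidInvariant.weaklyContains [IsProbabilityMeasure μ] (hμ : IsGroupoidInvariant μ)
    (Γ : Subgroup (TopFullGroup G)) :
    WeaklyContains ((TopFullGroup.canonicalRep G).comp Γ.subtype) (trivialRep Γ) := by
  -- The image of ℂΓ lies in C_c(G), and the constant function 1 is a common eigenvector with the
  -- augmentation as eigenvalue.
  have key : ∀ x : MonoidAlgebra ℂ Γ, ∃ f : Cc G,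
      groupAlgebraMap ((TopFullGroup.canonicalRep G).comp Γ.subtype) x = FullCStar.of f ∧
      f.act 1 = groupAlgebraMap (trivialRep Γ) x • 1 := by
    intro x
    induction x using MonoidAlgebra.induction_linear with
    | zero =>
      refine ⟨(0 : ℂ) • 1, ?_, ?_⟩
      · rw [map_zero, FullCStar.of_smul, zero_smul]
      · rw [map_zero, Cc.act_smul, zero_smul, zero_smul]
    | add x y hx hy =>
      obtain ⟨f, hf, hf1⟩ := hx
      obtain ⟨g, hg, hg1⟩ := hy
      exact ⟨f + g, by rw [map_add, hf, hg, FullCStar.of_add],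
        by rw [map_add, Cc.act_add, hf1, hg1, add_smul]⟩
    | single g z =>
      refine ⟨z • g.1.charFn, ?_, ?_⟩
      · rw [groupAlgebraMap_single, FullCStar.of_smul]
        rfl
      · rw [groupAlgebraMap_single, Cc.act_smul, Cc.act_charFn]
        congr 1
        exact (mul_one z).symm
  intro x
  obtain ⟨f, hf, hf1⟩ := key x
  rw [hf, FullCStar.norm_of]
  have h1 : actLp μ f (unitToLp μ 1) = groupAlgebraMap (trivialRep Γ) x • unitToLp μ 1 := by
    rw [hμ.actLp_apply, hf1, map_smul]
  -- The Koopman representation is one of those over which the full norm is a supremum.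
  have h2 : ‖actLp μ f‖ ≤ ‖f‖ := Cc.norm_rep_le hμ.koopman f
  have h3 : 0 < ‖unitToLp μ (1 : C(UnitSpace G, ℂ))‖ := by
    rw [norm_pos_iff]
    intro h0
    have h4 : ⟪unitToLp μ (1 : C(UnitSpace G, ℂ)), unitToLp μ 1⟫_ℂ = 1 := by
      rw [ContinuousMap.inner_toLp]
      simp
    rw [h0, inner_zero_left] at h4
    exact zero_ne_one h4
  refine le_of_mul_le_mul_right ?_ h3
  calc ‖groupAlgebraMap (trivialRep Γ) x‖ * ‖unitToLp μ 1‖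
      = ‖actLp μ f (unitToLp μ 1)‖ := by rw [h1, norm_smul]
    _ ≤ ‖f‖ * ‖unitToLp μ 1‖ := (actLp μ f).le_of_opNorm_le h2 _

end Koopman

end TopologicalGroupoid

open TopologicalGroupoid in
theorem proposition3p5 {G : Type u} [TopologicalSpace G] [TopologicalGroupoid G] [IsAmple G]
    [CompactSpace (UnitSpace G)] [MeasurableSpace (UnitSpace G)] [BorelSpace (UnitSpace G)]
    (Γ : Subgroup (TopFullGroup G)) :
    ((∃ μ : MeasureTheory.Measure (UnitSpace G),
        MeasureTheory.IsProbabilityMeasure μ ∧ μ.Regular ∧ IsGroupoidInvariant μ) →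
      WeaklyContains ((TopFullGroup.canonicalRep G).comp Γ.subtype) (trivialRep Γ)) ∧
    (WeaklyContains ((TopFullGroup.canonicalRep G).comp Γ.subtype) (trivialRep Γ) →
      HasCharacter ((TopFullGroup.canonicalRep G).comp Γ.subtype)) ∧
    (HasCharacter ((TopFullGroup.canonicalRep G).comp Γ.subtype) →
      ∃ μ : MeasureTheory.Measure (UnitSpace G),
        MeasureTheory.IsProbabilityMeasure μ ∧ μ.Regular ∧ IsSubgroupInvariant Γ μ) ∧
    (TopFullGroup.Covers Γ →
      List.TFAE [
        ∃ μ : MeasureTheory.Measure (UnitSpace G),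
          MeasureTheory.IsProbabilityMeasure μ ∧ μ.Regular ∧ IsGroupoidInvariant μ,
        WeaklyContains ((TopFullGroup.canonicalRep G).comp Γ.subtype) (trivialRep Γ),
        HasCharacter ((TopFullGroup.canonicalRep G).comp Γ.subtype),
        ∃ μ : MeasureTheory.Measure (UnitSpace G),
          MeasureTheory.IsProbabilityMeasure μ ∧ μ.Regular ∧ IsSubgroupInvariant Γ μ]) := by
  have h12 : (∃ μ : MeasureTheory.Measure (UnitSpace G),
      MeasureTheory.IsProbabilityMeasure μ ∧ μ.Regular ∧ IsGroupoidInvariant μ) →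
      WeaklyContains ((TopFullGroup.canonicalRep G).comp Γ.subtype) (trivialRep Γ) := by
    rintro ⟨μ, _, _, hμ⟩
    exact hμ.weaklyContains Γ
  have h23 := WeaklyContains.hasCharacter ((TopFullGroup.canonicalRep G).comp Γ.subtype)
  have h34 := exists_subgroupInvariant_measure (Γ := Γ)
  refine ⟨h12, h23, h34, fun hΓ => ?_⟩
  tfae_have 1 → 2 := h12
  tfae_have 2 → 3 := h23
  tfae_have 3 → 4 := h34
  tfae_have 4 → 1 := by
    rintro ⟨μ, hprob, hreg, hμ⟩
    exact ⟨μ, hprob, hreg, hμ.isGroupoidInvariant hΓ⟩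
  tfae_finish
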